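/- Let $\mathbb{T}=\mathbb{R}/2\pi\mathbb{Z}$ with the normalized measure $d\varphi/2\pi$, so that $\|f\|_{L^1}=\frac1{2\pi}\int_0^{2\pi}|f(\varphi)|\,d\varphi$ and $(f*g)(\theta)=\frac1{2\pi}\int_0^{2\pi}f(\varphi)g(\theta-\varphi)\,d\varphi$. For an integer $d\ge 0$ let $$E_{d}(f)_{L^1}=\inf\Big\{\|f-t\|_{L^1} : t(\varphi)=\sum_{|k|\le d}c_ke^{ik\varphi},\ c_k\in\mathbb{C}\Big\}.$$ For $h>0$ and $\theta\in(-\pi,\pi]$ put $\chi_h(\theta)=h^{-1}$ if $|\theta|\le\pi h$ and $\chi_h(\theta)=0$ otherwise, regarded as a function on $\mathbb{T}$, and let $\chi_h^m=\chi_h*\cdots*\chi_h$ ($m$ factors). Let $K_m=\frac4\pi\sum_{k\in4\mathbb{Z}+1}k^{-(m+1)}$ be the Favard constants. Then for all integers $n\ge1$ and $m\ge1$: 1. $E_{n-1}(\chi_h^m)_{L^1}=1$ for every $0<h\le\frac1{2mn}$; 2. $E_{n-1}(\chi_h^m)_{L^1}\le\dfrac{K_m}{(\pi hn)^m}$ for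 every $h>0$; 3. $E_{n-1}(\chi_h^m)_{L^1}=\dfrac{K_m}{(\pi hn)^m}$ for every $h\in\left\{\frac1{2n},\frac3{2n},\dots,\frac{2n-1}{2n}\right\}$. -/

import Mathlib

open Real MeasureTheory AddCircle
open scoped ENNReal

noncomputable section

namespace SteklovKernel

instance fact_two_pi_pos : Fact (0 < 2 * π) := ⟨Real.two_pi_pos⟩

/-- The circle `ℝ / 2πℤ`. -/
abbrev Torus : Type := AddCircle (2 * π)

/-- The normalized measure `dφ / 2π` on the circle (the Haar probability measure). -/
abbrev torusMeasure : Measure Torus := haarAddCircle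

/-- Trigonometric polynomials `∑_{|k| ≤ d} c_k e^{ikφ}` with complex coefficients, of degree at
most `d`; on the circle of length `2π`, `fourier k` is the character `e^{ikφ}`. -/
def trigPoly (d : ℕ) : Set (Torus → ℂ) :=
  {t | ∃ c : ℤ → ℂ, ∀ φ, t φ = ∑ k ∈ Finset.Icc (-(d : ℤ)) (d : ℤ), c k * fourier k φ}

/-- The best approximation of `f` in `L¹(dφ / 2π)` by trigonometric polynomials of degree at
most `d`, as an extended nonnegative real. -/
def bestApproxL1 (d : ℕ) (f : Torus → ℂ) : ℝ≥0∞ :=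
  ⨅ t ∈ trigPoly d, eLpNorm (fun φ => f φ - t φ) 1 torusMeasure

/-- The Favard constant `K_r = (4 / π) ∑_{k ∈ 4ℤ + 1} k ^ (-(r + 1))` (absolutely convergent for
`r ≥ 1`). -/
def favard (r : ℕ) : ℝ :=
  4 / π * ∑' j : ℤ, 1 / (4 * (j : ℝ) + 1) ^ (r + 1)

/-- `χ_h θ = 1 / h` for `|θ| ≤ π h` and `0` elsewhere on the circle. The norm of a point of the
circle is the absolute value of its representative in `(-π, π]`. -/
def chi (h : ℝ) : Torus → ℂ :=
  Set.indicator {θ : Torus | ‖θ‖ ≤ π * h} (fun _ => ((h⁻¹ : ℝ) : ℂ))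

/-- Convolution on the circle, `(f * g)(θ) = (1 / 2π) ∫ f(φ) g(θ - φ) dφ`. -/
def conv (f g : Torus → ℂ) : Torus → ℂ :=
  convolution f g (ContinuousLinearMap.mul ℂ ℂ) torusMeasure

/-- The `m`-fold convolution `χ_h * ⋯ * χ_h` (with `m ≥ 1` factors; the value at `m = 0` is a
placeholder that is never used). -/
def chiPow (h : ℝ) : ℕ → Torus → ℂ
  | 0 => 0
  | 1 => chi h
  | m + 2 => conv (chi h) (chiPow h (m + 1))

end SteklovKernel

end

noncomputable section

namespace SteklovKernel

open Filter Topology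

/-! Lower bounds come from duality (`le_bestApproxL1`) with the dilated square wave `S(x) = sgn
cos(nx)`. It is unimodular, and its spectrum lies in the nonzero multiples of `n`, so it annihilates
all polynomials of degree below `n`. For `h ≤ 1/(2mn)` the kernel lives where `S = 1`, so the
pairing is the mass 1 of the kernel, which the approximant `0` attains. For `h = (2k-1)/(2n)`
Parseval turns the pairing into a series of powers of `sin(πhnl)/(πhnl)` over odd `l`. On `l ∈ 4ℤ +
1` the sine has the same value `±1` for every `l`, and Favard's series remains
(`integral_chiPow_mul_squareWave`).

For the upper bound with `h < 1`, the coefficients of `χ_h^m` are `(sin(πhk)/(πh))^m · k^(-m)`. The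
first factor is the symbol of an `m`-fold symmetric difference quotient, of `L¹` norm at most
`(πh)^(-m)`. It therefore suffices to find `R` with coefficients `k^(-m)` for `|k| ≥ n` and norm at
most `K_m / n^m` (`exists_favard_remainder`, used in `bestApproxL1_chiPow_le`).

To build `R`, write `|k|^(-m)` as a Laplace integral of `e^(-u|k|)` and put `ε = (-1)^m`. For each
`u` the function `remainder n ε u` has coefficients `e^(-uk)` for `k ≥ n` and `ε e^(-u|k|)` for `k ≤
-n`. It is a positive multiple of `cos nx` or `i sin nx`, because the Poisson kernel is positive.
Its sign pattern does not depend on `u`, so its norm is a pairing with one fixed dilated wave,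
computed by Parseval. Integrating over `u` gives `K_m / n^m`. -/

/-! ### Uniqueness of Fourier coefficients and Parseval's identity -/

theorem norm_fourier_apply (k : ℤ) (x : Torus) : ‖fourier k x‖ = 1 :=
  Circle.norm_coe _

theorem integral_fourier_mul (f : Torus → ℂ) (k : ℤ) :
    ∫ x, fourier k x * f x ∂torusMeasure = fourierCoeff f (-k) := by
  simp only [fourierCoeff, neg_neg, smul_eq_mul]

/-- An integrable function whose integrals against all continuous functions vanish is zero. -/
theorem ae_eq_zero_of_forall_integral_continuous_mul_eq_zero {f : Torus → ℂ}
    (hf : Integrable f torusMeasure)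
    (h : ∀ g : C(Torus, ℂ), ∫ x, g x * f x ∂torusMeasure = 0) : f =ᵐ[torusMeasure] 0 := by
  refine ae_eq_zero_of_forall_setIntegral_isCompact_eq_zero' hf.locallyIntegrable ?_
  intro K hK
  obtain ⟨u, -, hupos, hu⟩ := exists_seq_strictAnti_tendsto (0 : ℝ)
  -- The continuous thickened indicators of `K` converge pointwise to its indicator, since `K` is
  -- closed.
  have key := tendsto_integral_of_dominated_convergence
    (μ := torusMeasure)
    (F := fun n x => ((thickenedIndicator (hupos n) K x : ℝ) : ℂ) * f x)
    (f := K.indicator f) (fun x => ‖f x‖) ?_ hf.norm ?_ ?_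
  · have h0 : ∀ n, ∫ x, ((thickenedIndicator (hupos n) K x : ℝ) : ℂ) * f x ∂torusMeasure = 0 := by
      intro n
      exact h ⟨fun x => ((thickenedIndicator (hupos n) K x : ℝ) : ℂ), by fun_prop⟩
    simp only [h0] at key
    rw [← integral_indicator hK.measurableSet]
    exact (tendsto_nhds_unique key tendsto_const_nhds)
  · intro n
    refine AEStronglyMeasurable.mul ?_ hf.1
    exact Continuous.aestronglyMeasurable (by fun_prop)
  · intro n
    refine Eventually.of_forall fun x => ?_
    rw [norm_mul]
    have : ‖((thickenedIndicator (hupos n) K x : ℝ) : ℂ)‖ ≤ 1 := by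
      rw [Complex.norm_real, Real.norm_of_nonneg (NNReal.coe_nonneg _)]
      exact_mod_cast thickenedIndicator_le_one (hupos n) K x
    simpa using mul_le_mul_of_nonneg_right this (norm_nonneg (f x))
  · refine Eventually.of_forall fun x => ?_
    have := tendsto_pi_nhds.1 (thickenedIndicator_tendsto_indicator_closure hupos hu K) x
    rw [hK.isClosed.closure_eq] at this
    have h2 : Tendsto (fun n => ((thickenedIndicator (hupos n) K x : ℝ) : ℂ)) atTop
        (𝓝 (((K.indicator (fun _ => (1 : NNReal)) x : NNReal) : ℝ) : ℂ)) :=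
      ((Complex.continuous_ofReal.comp NNReal.continuous_coe).tendsto _).comp this
    have h3 := h2.mul_const (f x)
    refine h3.trans_eq ?_
    by_cases hx : x ∈ K <;> simp [hx]

/-- Fourier coefficients determine an integrable function. -/
theorem ae_eq_zero_of_fourierCoeff_eq_zero {f : Torus → ℂ} (hf : Integrable f torusMeasure)
    (h : ∀ k, fourierCoeff f k = 0) : f =ᵐ[torusMeasure] 0 := by
  refine ae_eq_zero_of_forall_integral_continuous_mul_eq_zero hf fun g => ?_
  have hint : ∀ g : C(Torus, ℂ), Integrable (fun x => g x * f x) torusMeasure := fun g =>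
    hf.bdd_mul (c := ‖g‖) g.continuous.aestronglyMeasurable
      (Eventually.of_forall g.norm_coe_le_norm)
  let Φ : C(Torus, ℂ) →ₗ[ℂ] ℂ :=
    { toFun := fun g => ∫ x, g x * f x ∂torusMeasure
      map_add' := fun a b => by
        simp only [ContinuousMap.add_apply, add_mul]
        exact integral_add (hint a) (hint b)
      map_smul' := fun c a => by
        simp only [ContinuousMap.smul_apply, smul_eq_mul, mul_assoc, RingHom.id_apply]
        exact integral_const_mul _ _ }
  have hb : ∀ g, ‖Φ g‖ ≤ (∫ x, ‖f x‖ ∂torusMeasure) * ‖g‖ := by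
    intro g
    refine (norm_integral_le_integral_norm _).trans ?_
    rw [mul_comm _ ‖g‖, ← integral_const_mul]
    refine integral_mono (hint g).norm (hf.norm.const_mul _) fun x => ?_
    simp only [norm_mul]
    exact mul_le_mul_of_nonneg_right (g.norm_coe_le_norm x) (norm_nonneg _)
  let Ψ := Φ.mkContinuous _ hb
  -- The kernel of a bounded functional is closed, and the span of the characters is dense.
  have hker : (⊤ : Submodule ℂ C(Torus, ℂ)) ≤ LinearMap.ker (Ψ : C(Torus, ℂ) →ₗ[ℂ] ℂ) := by
    rw [← span_fourier_closure_eq_top]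
    refine Submodule.topologicalClosure_minimal _ ?_ Ψ.isClosed_ker
    rw [Submodule.span_le]
    rintro _ ⟨k, rfl⟩
    change ∫ x, fourier k x * f x ∂torusMeasure = 0
    rw [integral_fourier_mul, h]
  exact hker (Submodule.mem_top : g ∈ ⊤)

/-- Parseval's identity for the bilinear pairing. -/
theorem hasSum_fourierCoeff_mul {f g : Torus → ℂ} (hf : MemLp f 2 torusMeasure)
    (hg : MemLp g 2 torusMeasure) :
    HasSum (fun k => fourierCoeff f k * fourierCoeff g (-k)) (∫ x, f x * g x ∂torusMeasure) := by
  -- Conjugating `g` turns the sesquilinear inner product into the bilinear pairing; this is the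
  -- source of the index `-k`.
  have hg' : MemLp (fun x => (starRingEnd ℂ) (g x)) 2 torusMeasure := hg.star
  have h := HilbertBasis.hasSum_inner_mul_inner (fourierBasis (T := 2 * π)) (hg'.toLp) (hf.toLp)
  convert! h using 1
  · funext k
    have h1 : fourierCoeff f k = inner ℂ (fourierBasis k) hf.toLp := by
      rw [← HilbertBasis.repr_apply_apply, fourierBasis_repr]
      exact congrFun (fourierCoeff_congr_ae hf.coeFn_toLp.symm) k
    have h2 : fourierCoeff g (-k) = inner ℂ hg'.toLp (fourierBasis k) := by
      rw [← inner_conj_symm, ← HilbertBasis.repr_apply_apply, fourierBasis_repr,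
        fourierCoeff_congr_ae hg'.coeFn_toLp, fourierCoeff, fourierCoeff, ← integral_conj]
      refine integral_congr_ae (Eventually.of_forall fun x => ?_)
      simp only [smul_eq_mul, map_mul, Complex.conj_conj, fourier_neg, neg_neg]
    rw [h1, h2, mul_comm]
  · rw [MeasureTheory.L2.inner_def]
    refine integral_congr_ae ?_
    filter_upwards [hf.coeFn_toLp, hg'.coeFn_toLp] with x h1 h2
    simp only [RCLike.inner_apply, h1, h2, Complex.conj_conj]

/-! ### Duality and spectral truncation for the best approximation -/

theorem trigPoly_continuous {d : ℕ} {t : Torus → ℂ} (ht : t ∈ trigPoly d) : Continuous t := by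
  obtain ⟨c, hc⟩ := ht
  rw [show t = _ from funext hc]
  fun_prop

theorem integrable_of_continuous {f : Torus → ℂ} (hf : Continuous f) :
    Integrable f torusMeasure :=
  hf.integrable_of_hasCompactSupport (HasCompactSupport.of_compactSpace f)

/-- Duality: a bounded function orthogonal to the trigonometric polynomials bounds the best
approximation from below. -/
theorem le_bestApproxL1 {d : ℕ} {f S : Torus → ℂ} (hf : Integrable f torusMeasure)
    (hS : AEStronglyMeasurable S torusMeasure) (hS1 : ∀ x, ‖S x‖ ≤ 1)
    (hS0 : ∀ k : ℤ, |k| ≤ d → fourierCoeff S k = 0) :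
    ENNReal.ofReal ‖∫ x, f x * S x ∂torusMeasure‖ ≤ bestApproxL1 d f := by
  refine le_iInf₂ fun t ht => ?_
  have htS : ∫ x, t x * S x ∂torusMeasure = 0 := by
    obtain ⟨c, hc⟩ := ht
    simp only [hc, Finset.sum_mul, mul_assoc]
    rw [integral_finsetSum]
    · refine Finset.sum_eq_zero fun k hk => ?_
      rw [integral_const_mul, integral_fourier_mul, hS0, mul_zero]
      rw [abs_neg, abs_le]
      exact Finset.mem_Icc.1 hk
    · intro k _
      refine Integrable.const_mul ?_ _
      exact (integrable_of_continuous (fourier k).continuous).mul_bdd (c := 1) hS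
        (Eventually.of_forall hS1)
  have hti := integrable_of_continuous (trigPoly_continuous ht)
  have h1 : ∫ x, f x * S x ∂torusMeasure = ∫ x, (f x - t x) * S x ∂torusMeasure := by
    simp only [sub_mul]
    rw [integral_sub, htS, sub_zero]
    · exact hf.mul_bdd (c := 1) hS (Eventually.of_forall hS1)
    · exact hti.mul_bdd (c := 1) hS (Eventually.of_forall hS1)
  rw [h1, ofReal_norm, eLpNorm_one_eq_lintegral_enorm]
  refine (enorm_integral_le_lintegral_enorm _).trans (lintegral_mono fun x => ?_)
  rw [enorm_mul]
  refine mul_le_of_le_one_right (zero_le) ?_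
  rw [← ofReal_norm]
  simpa using ENNReal.ofReal_le_ofReal (hS1 x)

/-- If `g` has the Fourier coefficients of `f` beyond degree `d`, then `f - g` is a trigonometric
polynomial, so that the norm of `g` bounds the best approximation of `f`. -/
theorem bestApproxL1_le_of_fourierCoeff_eq {d : ℕ} {f g : Torus → ℂ}
    (hf : Integrable f torusMeasure) (hg : Integrable g torusMeasure)
    (h : ∀ k : ℤ, (d : ℤ) < |k| → fourierCoeff f k = fourierCoeff g k) :
    bestApproxL1 d f ≤ eLpNorm g 1 torusMeasure := by
  classical
  let c : ℤ → ℂ := fun k => fourierCoeff f k - fourierCoeff g k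
  let t : Torus → ℂ := fun φ => ∑ k ∈ Finset.Icc (-(d : ℤ)) (d : ℤ), c k * fourier k φ
  have ht : t ∈ trigPoly d := ⟨c, fun _ => rfl⟩
  have hti := integrable_of_continuous (trigPoly_continuous ht)
  have htc : ∀ k, fourierCoeff t k = c k := by
    intro k
    have : t = ∑ j ∈ Finset.Icc (-(d : ℤ)) (d : ℤ), (c j • (fourier j : Torus → ℂ)) := by
      funext x; simp [t, -fourier_apply]
    rw [this, fourierCoeff.sum _ _ fun j _ =>
      (integrable_of_continuous (fourier j).continuous).smul (c j), Finset.sum_apply]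
    have h2 : ∀ j, fourierCoeff (c j • (fourier j : Torus → ℂ)) k
        = if k = j then c j else 0 := by
      intro j
      rw [fourierCoeff.const_smul, fourierCoeff_fourier, Pi.single_apply]
      split_ifs <;> simp
    simp only [h2, Finset.sum_ite_eq]
    split_ifs with hk
    · rfl
    · have : (d : ℤ) < |k| := by
        rw [Finset.mem_Icc, ← abs_le] at hk
        exact not_le.1 hk
      simp [c, h k this]
  have hzero := ae_eq_zero_of_fourierCoeff_eq_zero (f := f + (-1 : ℂ) • g + (-1 : ℂ) • t)
    ((hf.add (hg.smul _)).add (hti.smul _)) fun k => by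
      rw [fourierCoeff.add (hf.add (hg.smul _)) (hti.smul _), fourierCoeff.add hf (hg.smul _)]
      simp only [Pi.add_apply, fourierCoeff.const_smul, htc, c, smul_eq_mul]
      ring
  refine (iInf₂_le t ht).trans (le_of_eq (eLpNorm_congr_ae ?_))
  filter_upwards [hzero] with x hx
  simp only [Pi.add_apply, Pi.smul_apply, smul_eq_mul, Pi.zero_apply] at hx
  linear_combination hx

/-! ### Convolution powers and the coefficients of `χ_h^m` -/

theorem integrable_conv {f g : Torus → ℂ} (hf : Integrable f torusMeasure)
    (hg : Integrable g torusMeasure) : Integrable (conv f g) torusMeasure :=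
  hf.integrable_convolution _ hg

/-- Characters are multiplicative, so they pass inside a convolution. A coefficient of `f * g` is
thus the total integral of a convolution, which factors. -/
theorem fourier_mul_conv (f g : Torus → ℂ) (k : ℤ) (x : Torus) :
    fourier k x * conv f g x
      = conv (fun y => fourier k y * f y) (fun y => fourier k y * g y) x := by
  simp only [conv, convolution_def, ContinuousLinearMap.mul_apply', ← integral_const_mul]
  refine integral_congr_ae (Eventually.of_forall fun y => ?_)
  have : (fourier k x : ℂ) = fourier k y * fourier k (x - y) := by
    simp only [fourier_apply]
    rw [← Circle.coe_mul, ← toCircle_add, ← smul_add, add_sub_cancel]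
  simp only [this]
  ring

theorem fourierCoeff_conv {f g : Torus → ℂ} (hf : Integrable f torusMeasure)
    (hg : Integrable g torusMeasure) (k : ℤ) :
    fourierCoeff (conv f g) k = fourierCoeff f k * fourierCoeff g k := by
  simp only [fourierCoeff, smul_eq_mul, fourier_mul_conv]
  exact integral_convolution _ (hf.fourier_smul (-k)) (hg.fourier_smul (-k))

theorem norm_conv_le {f g : Torus → ℂ} {A B : ℝ} (hf : ∀ x, ‖f x‖ ≤ A) (hg : ∀ x, ‖g x‖ ≤ B)
    (x : Torus) : ‖conv f g x‖ ≤ A * B := by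
  have hA : 0 ≤ A := (norm_nonneg _).trans (hf 0)
  have := norm_integral_le_of_norm_le_const (μ := (torusMeasure : Measure Torus))
    (f := fun t => f t * g (x - t)) (C := A * B) (Eventually.of_forall fun t => by
      rw [norm_mul]
      exact mul_le_mul (hf t) (hg _) (norm_nonneg _) hA)
  simpa [conv, convolution_def] using this

theorem measurable_chi (h : ℝ) : Measurable (chi h) :=
  measurable_const.indicator (measurableSet_le measurable_norm measurable_const)

theorem norm_chi_le (h : ℝ) (x : Torus) : ‖chi h x‖ ≤ |h⁻¹| := by
  refine (norm_indicator_le_norm_self _ _).trans ?_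
  simp

theorem integrable_chi (h : ℝ) : Integrable (chi h) torusMeasure :=
  Integrable.of_bound (measurable_chi h).aestronglyMeasurable _ (Eventually.of_forall (norm_chi_le h))

theorem integrable_chiPow (h : ℝ) : ∀ m : ℕ, Integrable (chiPow h m) torusMeasure
  | 0 => integrable_zero _ _ _
  | 1 => integrable_chi h
  | m + 2 => integrable_conv (integrable_chi h) (integrable_chiPow h (m + 1))

theorem norm_chiPow_le (h : ℝ) : ∀ (m : ℕ) (x : Torus), ‖chiPow h m x‖ ≤ |h⁻¹| ^ m
  | 0, x => by simp [chiPow]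
  | 1, x => (norm_chi_le h x).trans_eq (pow_one _).symm
  | m + 2, x => by
    rw [pow_succ']
    exact norm_conv_le (norm_chi_le h) (norm_chiPow_le h (m + 1)) x

theorem memLp_chiPow (h : ℝ) (m : ℕ) (p : ℝ≥0∞) : MemLp (chiPow h m) p torusMeasure :=
  MemLp.of_bound (integrable_chiPow h m).1 _ (Eventually.of_forall (norm_chiPow_le h m))

theorem fourierCoeff_chiPow (h : ℝ) (k : ℤ) : ∀ m : ℕ, 1 ≤ m →
    fourierCoeff (chiPow h m) k = fourierCoeff (chi h) k ^ m
  | 1, _ => (pow_one _).symm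
  | m + 2, _ => by
    rw [chiPow, fourierCoeff_conv (integrable_chi h) (integrable_chiPow h (m + 1)),
      fourierCoeff_chiPow h k (m + 1) (by omega), ← pow_succ']

theorem chi_coe {h x : ℝ} (hx : |x| ≤ π) :
    chi h (x : Torus) = (Set.Icc (-(π * h)) (π * h)).indicator (fun _ => ((h⁻¹ : ℝ) : ℂ)) x := by
  have h1 : ‖(x : Torus)‖ = |x| := by
    rw [AddCircle.norm_coe_eq_abs_iff _ Real.two_pi_pos.ne', abs_of_pos Real.two_pi_pos]
    linarith
  simp only [chi, Set.indicator, Set.mem_ofPred_eq, h1, abs_le, Set.mem_Icc]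

theorem fourier_coe (k : ℤ) (x : ℝ) :
    (fourier k (x : Torus) : ℂ) = Complex.exp ((k * Complex.I) * x) := by
  rw [fourier_coe_apply]
  congr 1
  push_cast
  field_simp [Complex.ofReal_ne_zero.2 Real.pi_ne_zero]

theorem fourierCoeff_chi {h : ℝ} (h0 : 0 < h) (h1 : h ≤ 1) (k : ℤ) :
    fourierCoeff (chi h) k = ((sinc (π * h * k) : ℝ) : ℂ) := by
  have hπ := Real.pi_pos
  have hle : -(π * h) ≤ π * h := by nlinarith
  have hph : π * h ≤ π := by nlinarith
  rw [fourierCoeff_eq_intervalIntegral _ _ (-π), show -π + 2 * π = π by ring,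
    intervalIntegral.integral_of_le (by linarith)]
  have e1 : ∫ x in Set.Ioc (-π) π, (fourier (-k) (x : Torus) : ℂ) • chi h (x : Torus)
      = ∫ x in Set.Ioc (-π) π, (Set.Icc (-(π * h)) (π * h)).indicator
        (fun x : ℝ => Complex.exp (((-k : ℤ) * Complex.I) * x) * ((h⁻¹ : ℝ) : ℂ)) x := by
    refine setIntegral_congr_fun measurableSet_Ioc fun x hx => ?_
    rw [chi_coe (abs_le.2 ⟨hx.1.le, hx.2⟩), fourier_coe]
    simp only [Set.indicator]
    split_ifs <;> simp
  have e2 : ∫ x in Set.Ioc (-π) π, (Set.Icc (-(π * h)) (π * h)).indicator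
        (fun x : ℝ => Complex.exp (((-k : ℤ) * Complex.I) * x) * ((h⁻¹ : ℝ) : ℂ)) x
      = ∫ x in (-(π * h))..(π * h),
        Complex.exp (((-k : ℤ) * Complex.I) * x) * ((h⁻¹ : ℝ) : ℂ) := by
    rw [← integral_Icc_eq_integral_Ioc, setIntegral_indicator measurableSet_Icc,
      Set.inter_eq_right.2 (Set.Icc_subset_Icc (by linarith) hph), integral_Icc_eq_integral_Ioc,
      ← intervalIntegral.integral_of_le hle]
  rw [e1, e2, intervalIntegral.integral_mul_const]
  rcases eq_or_ne k 0 with rfl | hk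
  · simp
    norm_cast
    field_simp
    norm_num
  · have hk' : (k : ℂ) ≠ 0 := by exact_mod_cast hk
    have hkr : (k : ℝ) ≠ 0 := by exact_mod_cast hk
    rw [integral_exp_mul_complex (by simpa using hk'), sinc_of_ne_zero (by positivity)]
    have hπ' : (π : ℂ) ≠ 0 := by exact_mod_cast hπ.ne'
    have hh' : (h : ℂ) ≠ 0 := by exact_mod_cast h0.ne'
    push_cast
    rw [Complex.sin]
    rw [Complex.real_smul]
    push_cast
    have a1 : (-(k : ℂ) * Complex.I) * (π * h) = -(π * h * k) * Complex.I := by ring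
    have a2 : (-(k : ℂ) * Complex.I) * -(π * h) = (π * h * k) * Complex.I := by ring
    rw [a1, a2]
    field_simp
    rw [Complex.I_sq]
    ring

/-! ### Translations, dilations and the square wave -/

theorem fourierCoeff_comp_add_right (f : Torus → ℂ) (a : Torus) (k : ℤ) :
    fourierCoeff (fun x => f (x + a)) k = fourier k a * fourierCoeff f k := by
  have h := integral_add_right_eq_self (μ := (torusMeasure : Measure Torus))
    (fun x => (fourier (-k) x : ℂ) * f x) a
  have h2 : ∀ x, (fourier (-k) (x + a) : ℂ) * f (x + a)
      = fourier (-k) a * (fourier (-k) x * f (x + a)) := by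
    intro x
    simp only [fourier_apply]
    rw [smul_add, toCircle_add, Circle.coe_mul]
    ring
  simp only [h2, integral_const_mul] at h
  simp only [fourierCoeff, smul_eq_mul, ← h]
  rw [← mul_assoc, ← fourier_add, add_neg_cancel, fourier_zero, one_mul]

/-- The map `x ↦ n • x` preserves Haar measure and pulls the character `l` back to `n * l`. -/
theorem fourierCoeff_comp_nsmul_mul {f : Torus → ℂ} (hf : AEStronglyMeasurable f torusMeasure)
    {n : ℕ} (hn : n ≠ 0) (l : ℤ) :
    fourierCoeff (fun x => f (n • x)) (n * l) = fourierCoeff f l := by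
  have hmp := Measure.measurePreserving_zsmul (torusMeasure : Measure Torus) (n := (n : ℤ)) (by exact_mod_cast hn)
  have hm : AEStronglyMeasurable (fun x => (fourier (-l) x : ℂ) • f x) torusMeasure :=
    (fourier (-l)).continuous.aestronglyMeasurable.smul hf
  simp only [fourierCoeff]
  rw [← hmp.map_eq] at hm
  have hi := integral_map hmp.measurable.aemeasurable hm
  rw [hmp.map_eq] at hi
  refine Eq.trans ?_ hi.symm
  refine integral_congr_ae (Eventually.of_forall fun x => ?_)
  simp only [fourier_apply, natCast_zsmul]
  congr 2
  rw [← natCast_zsmul x n, smul_smul]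
  congr 3
  ring

/-- Translation by `2π/n` fixes the function but multiplies its coefficient by `e^(2πik/n)`, which
is not 1. -/
theorem fourierCoeff_comp_nsmul_of_not_dvd (f : Torus → ℂ) {n : ℕ} (hn : n ≠ 0) {k : ℤ}
    (hk : ¬ (n : ℤ) ∣ k) : fourierCoeff (fun x => f (n • x)) k = 0 := by
  have hn' : (n : ℂ) ≠ 0 := by exact_mod_cast hn
  let a : Torus := ((2 * π / n : ℝ) : Torus)
  have ha : n • a = 0 := by
    rw [← AddCircle.coe_nsmul, nsmul_eq_mul, mul_div_cancel₀ _ (by exact_mod_cast hn)]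
    exact AddCircle.coe_period _
  have h := fourierCoeff_comp_add_right (fun x => f (n • x)) a k
  simp only [smul_add, ha, add_zero] at h
  by_contra h0
  have h1 : (fourier k a : ℂ) = 1 := by
    have : fourierCoeff (fun x => f (n • x)) k * (fourier k a - 1) = 0 := by
      linear_combination -h
    exact sub_eq_zero.1 ((mul_eq_zero.1 this).resolve_left h0)
  rw [fourier_coe, Complex.exp_eq_one_iff] at h1
  obtain ⟨j, hj⟩ := h1
  apply hk
  refine ⟨j, ?_⟩
  have hπ' : (π : ℂ) ≠ 0 := by exact_mod_cast Real.pi_ne_zero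
  have : (k : ℂ) = n * j := by
    push_cast at hj
    field_simp at hj
    linear_combination hj
  exact_mod_cast this

/-- The square wave `sgn (cos θ)`. -/
def squareWave : Torus → ℂ := fun x => chi (1 / 2) x - 1

theorem squareWave_apply (x : Torus) : squareWave x = if ‖x‖ ≤ π / 2 then 1 else -1 := by
  simp only [squareWave, chi, Set.indicator, Set.mem_ofPred_eq, mul_one_div]
  split_ifs <;> norm_num

theorem norm_squareWave (x : Torus) : ‖squareWave x‖ = 1 := by
  rw [squareWave_apply]
  split_ifs <;> simp

theorem measurable_squareWave : Measurable squareWave :=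
  (measurable_chi _).sub_const 1

theorem fourierCoeff_squareWave (l : ℤ) :
    fourierCoeff squareWave l = if l = 0 then 0 else ((sinc (π * l / 2) : ℝ) : ℂ) := by
  have h1 : squareWave = chi (1 / 2) + (-1 : ℂ) • (fourier 0 : Torus → ℂ) := by
    funext x
    simp [squareWave, sub_eq_add_neg]
  rw [h1, fourierCoeff.add (integrable_chi _)
    ((integrable_of_continuous (fourier 0).continuous).smul _), Pi.add_apply,
    fourierCoeff.const_smul, fourierCoeff_fourier, fourierCoeff_chi (by norm_num) (by norm_num),
    show π * (1 / 2) * (l : ℝ) = π * l / 2 by ring]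
  split_ifs with h
  · simp [h]
  · simp [h]

theorem measurable_squareWave_nsmul (n : ℕ) : Measurable (fun x : Torus => squareWave (n • x)) :=
  measurable_squareWave.comp (by fun_prop : Continuous fun x : Torus => n • x).measurable

theorem fourierCoeff_squareWave_nsmul_eq_zero {n : ℕ} (hn : 1 ≤ n) {k : ℤ}
    (hk : |k| ≤ ((n - 1 : ℕ) : ℤ)) : fourierCoeff (fun x => squareWave (n • x)) k = 0 := by
  by_cases hd : (n : ℤ) ∣ k
  · have : k = 0 := Int.eq_zero_of_abs_lt_dvd hd (by omega)
    subst this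
    have := fourierCoeff_comp_nsmul_mul (f := squareWave)
      measurable_squareWave.aestronglyMeasurable (n := n) (by omega) 0
    rw [mul_zero] at this
    rw [this, fourierCoeff_squareWave, if_pos rfl]
  · exact fourierCoeff_comp_nsmul_of_not_dvd _ (by omega) hd

/-! ### Small `h`: support and positivity of the kernel -/

theorem norm_le_of_chiPow_ne_zero (h : ℝ) : ∀ (m : ℕ) (x : Torus), chiPow h m x ≠ 0 →
    ‖x‖ ≤ m * (π * h)
  | 0, x, hx => by simp [chiPow] at hx
  | 1, x, hx => by
    by_contra hc
    apply hx
    simp only [chiPow, chi]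
    rw [Set.indicator_of_notMem]
    simpa using hc
  | m + 2, x, hx => by
    obtain ⟨a, ha, b, hb, rfl⟩ := Set.mem_add.1
      (support_convolution_subset (ContinuousLinearMap.mul ℂ ℂ) (μ := torusMeasure)
        (f := chi h) (g := chiPow h (m + 1)) hx)
    have h1 := norm_le_of_chiPow_ne_zero h 1 a ha
    have h2 := norm_le_of_chiPow_ne_zero h (m + 1) b hb
    refine (norm_add_le _ _).trans ?_
    push_cast at h1 h2 ⊢
    linarith

/-- Nonnegativity in a form that identifies the `L¹` norm with the zeroth Fourier coefficient. -/
theorem chiPow_eq_ofReal_norm {h : ℝ} (h0 : 0 < h) : ∀ (m : ℕ) (x : Torus),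
    chiPow h m x = ((‖chiPow h m x‖ : ℝ) : ℂ)
  | 0, x => by simp [chiPow]
  | 1, x => by
    simp only [chiPow, chi, Set.indicator]
    split_ifs
    · rw [Complex.norm_real, Real.norm_of_nonneg (by positivity)]
    · simp
  | m + 2, x => by
    have h1 : chiPow h (m + 2) x
        = ((∫ t, ‖chiPow h 1 t‖ * ‖chiPow h (m + 1) (x - t)‖ ∂torusMeasure : ℝ) : ℂ) := by
      rw [← integral_complex_ofReal]
      simp only [chiPow, conv, convolution_def, ContinuousLinearMap.mul_apply']
      refine integral_congr_ae (Eventually.of_forall fun t => ?_)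
      simp only [Complex.ofReal_mul]
      have a := chiPow_eq_ofReal_norm h0 1 t
      have b := chiPow_eq_ofReal_norm h0 (m + 1) (x - t)
      simp only [chiPow] at a
      rw [← a, ← b]
    rw [h1, Complex.norm_real, Real.norm_of_nonneg]
    exact integral_nonneg fun t => by positivity

theorem eLpNorm_chiPow {h : ℝ} (h0 : 0 < h) (h1 : h ≤ 1) {m : ℕ} (hm : 1 ≤ m) :
    eLpNorm (chiPow h m) 1 torusMeasure = 1 := by
  have hi := integrable_chiPow h m
  have h2 : ∫ x, chiPow h m x ∂torusMeasure = 1 := by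
    have := fourierCoeff_chiPow h 0 m hm
    rw [fourierCoeff_chi h0 h1] at this
    simpa [fourierCoeff] using this
  have h3 : ∫ x, ‖chiPow h m x‖ ∂torusMeasure = 1 := by
    have h4 : ∫ x, chiPow h m x ∂torusMeasure = ((∫ x, ‖chiPow h m x‖ ∂torusMeasure : ℝ) : ℂ) := by
      rw [← integral_complex_ofReal]
      exact integral_congr_ae (Eventually.of_forall (chiPow_eq_ofReal_norm h0 m))
    rw [h2] at h4
    exact_mod_cast h4.symm
  rw [eLpNorm_one_eq_lintegral_enorm, ← ofReal_integral_norm_eq_lintegral_enorm hi, h3,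
    ENNReal.ofReal_one]

theorem zero_mem_trigPoly (d : ℕ) : (0 : Torus → ℂ) ∈ trigPoly d :=
  ⟨0, fun _ => by simp⟩

theorem ofReal_norm_integral_le_bestApproxL1 {n : ℕ} (hn : 1 ≤ n) {f : Torus → ℂ}
    (hf : Integrable f torusMeasure) :
    ENNReal.ofReal ‖∫ x, f x * squareWave (n • x) ∂torusMeasure‖ ≤ bestApproxL1 (n - 1) f :=
  le_bestApproxL1 hf (measurable_squareWave_nsmul n).aestronglyMeasurable
    (fun _ => (norm_squareWave _).le) fun _ hk => fourierCoeff_squareWave_nsmul_eq_zero hn hk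

theorem bestApproxL1_chiPow_eq_one {n m : ℕ} (hn : 1 ≤ n) (hm : 1 ≤ m) {h : ℝ} (h0 : 0 < h)
    (hle : h ≤ 1 / (2 * (m : ℝ) * (n : ℝ))) : bestApproxL1 (n - 1) (chiPow h m) = 1 := by
  have hn' : (1 : ℝ) ≤ n := by exact_mod_cast hn
  have hm' : (1 : ℝ) ≤ m := by exact_mod_cast hm
  have hmn : h * (2 * m * n) ≤ 1 := (le_div_iff₀ (by positivity)).1 hle
  have h1 : h ≤ 1 := by nlinarith [mul_le_mul hm' hn' zero_le_one (by positivity)]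
  refine le_antisymm ?_ ?_
  · refine (iInf₂_le 0 (zero_mem_trigPoly _)).trans ?_
    simpa using (eLpNorm_chiPow h0 h1 hm).le
  · refine le_trans ?_ (ofReal_norm_integral_le_bestApproxL1 hn (integrable_chiPow h m))
    have h2 : ∫ x, chiPow h m x * squareWave (n • x) ∂torusMeasure = 1 := by
      have h3 := fourierCoeff_chiPow h 0 m hm
      rw [fourierCoeff_chi h0 h1] at h3
      simp only [fourierCoeff, neg_zero, fourier_zero, one_smul, Int.cast_zero, mul_zero, sinc_zero,
        Complex.ofReal_one, one_pow] at h3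
      rw [← h3]
      refine integral_congr_ae (Eventually.of_forall fun x => ?_)
      by_cases hx : chiPow h m x = 0
      · simp [hx]
      · have hb := norm_le_of_chiPow_ne_zero h m x hx
        -- On the support, `n‖x‖ ≤ n · m · πh ≤ π/2`, by the assumed bound on `h`.
        have : ‖n • x‖ ≤ π / 2 := by
          refine (norm_nsmul_le).trans ?_
          nlinarith [Real.pi_pos]
        simp [squareWave_apply, this]
    simp [h2]

/-! ### The lower bound at `h = (2k - 1)/(2n)` -/

theorem hasSum_int_mul_of_not_dvd {F : ℤ → ℂ} {a : ℂ} (hF : HasSum F a) {n : ℕ} (hn : n ≠ 0)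
    (h : ∀ k, ¬ (n : ℤ) ∣ k → F k = 0) : HasSum (fun l : ℤ => F (n * l)) a := by
  have hinj : Function.Injective fun l : ℤ => (n : ℤ) * l :=
    mul_right_injective₀ (by exact_mod_cast hn)
  refine (hinj.hasSum_iff fun k hk => h k ?_).2 hF
  rintro ⟨l, rfl⟩
  exact hk ⟨l, rfl⟩

/-- An even summable family supported on the odd integers is summed over `4ℤ + 1`. -/
theorem hasSum_four_mul_add_one {F : ℤ → ℂ} {a : ℂ} (hF : HasSum F a)
    (h0 : ∀ l, Even l → F l = 0) (hneg : ∀ l, F (-l) = F l) :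
    HasSum (fun j : ℤ => 2 * F (4 * j + 1)) a := by
  classical
  let A : Set ℤ := Set.range fun j : ℤ => 4 * j + 1
  have hinj : Function.Injective fun j : ℤ => 4 * j + 1 := fun i j hij => by
    simp only at hij; omega
  have hs : HasSum (fun j : ℤ => F (4 * j + 1)) (∑' j : ℤ, F (4 * j + 1)) :=
    (hF.summable.comp_injective hinj).hasSum
  have hG : HasSum (A.indicator F) (∑' j : ℤ, F (4 * j + 1)) := by
    refine (hinj.hasSum_iff fun k hk => Set.indicator_of_notMem hk _).1 ?_
    have he : A.indicator F ∘ (fun j : ℤ => 4 * j + 1) = fun j => F (4 * j + 1) :=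
      funext fun j => Set.indicator_of_mem (Set.mem_range_self j) F
    rwa [he]
  have hG' := (Equiv.neg ℤ).hasSum_iff.2 hG
  have hsum := hG.add hG'
  -- Every odd integer lies in exactly one of `4ℤ + 1` and `-(4ℤ + 1)`.
  have hFG : (fun l => A.indicator F l + (A.indicator F ∘ (Equiv.neg ℤ)) l) = F := by
    funext l
    simp only [Function.comp, Equiv.neg_apply]
    have hm : ∀ l : ℤ, l ∈ A ↔ l % 4 = 1 := fun l =>
      ⟨by rintro ⟨j, rfl⟩; simp only; omega, fun h => ⟨l / 4, by simp only; omega⟩⟩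
    simp only [Set.indicator, hm, hneg]
    by_cases he : Even l
    · simp [h0 l he]
    · rw [Int.not_even_iff] at he
      by_cases h1 : l % 4 = 1
      · rw [if_pos h1, if_neg (by omega), add_zero]
      · rw [if_neg h1, if_pos (by omega), zero_add]
  rw [hFG] at hsum
  rw [hF.unique hsum, ← two_mul]
  exact hs.mul_left 2

theorem four_mul_add_one_ne_zero (j : ℤ) : (4 * (j : ℝ) + 1) ≠ 0 := by
  have : (4 * j + 1 : ℤ) ≠ 0 := by omega
  exact_mod_cast this

theorem sinc_pi_mul_four_mul_add_one_div_two (j : ℤ) :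
    sinc (π * ((4 * j + 1 : ℤ) : ℝ) / 2) = 2 / (π * (4 * j + 1)) := by
  have h := four_mul_add_one_ne_zero j
  have hπ := Real.pi_pos.ne'
  push_cast
  rw [sinc_of_ne_zero (by positivity),
    show π * (4 * (j : ℝ) + 1) / 2 = π / 2 + j * (2 * π) by ring, Real.sin_add_int_mul_two_pi,
    Real.sin_pi_div_two]
  field_simp
  ring

theorem sinc_pi_mul_even_div_two {l : ℤ} (hl : Even l) (h0 : l ≠ 0) :
    sinc (π * (l : ℝ) / 2) = 0 := by
  obtain ⟨j, rfl⟩ := hl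
  have hj : (j : ℝ) ≠ 0 := by
    intro h
    exact h0 (by have : j = 0 := by exact_mod_cast h
                 omega)
  push_cast
  rw [show π * ((j : ℝ) + j) / 2 = j * π by ring, sinc_of_ne_zero (by positivity),
    Real.sin_int_mul_pi, zero_div]

theorem fourierCoeff_squareWave_of_even {l : ℤ} (hl : Even l) : fourierCoeff squareWave l = 0 := by
  rw [fourierCoeff_squareWave]
  split_ifs with h
  · rfl
  · rw [sinc_pi_mul_even_div_two hl h, Complex.ofReal_zero]

theorem fourierCoeff_squareWave_neg (l : ℤ) :
    fourierCoeff squareWave (-l) = fourierCoeff squareWave l := by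
  simp only [fourierCoeff_squareWave, neg_eq_zero, Int.cast_neg, mul_neg, neg_div, sinc_neg]

theorem fourierCoeff_squareWave_four_mul_add_one (j : ℤ) :
    fourierCoeff squareWave (4 * j + 1) = ((2 / (π * (4 * j + 1)) : ℝ) : ℂ) := by
  rw [fourierCoeff_squareWave, if_neg (by omega), sinc_pi_mul_four_mul_add_one_div_two]

theorem integral_chiPow_mul_squareWave {n m k : ℕ} (hn : 1 ≤ n) (hm : 1 ≤ m) (hk : 1 ≤ k)
    (hkn : k ≤ n) {h : ℝ} (hh : h = (2 * (k : ℝ) - 1) / (2 * (n : ℝ))) :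
    ∫ x, chiPow h m x * squareWave (n • x) ∂torusMeasure
      = ((sin (π * (2 * k - 1) / 2) ^ m * (favard m / (π * h * n) ^ m) : ℝ) : ℂ) := by
  have hn' : (1 : ℝ) ≤ n := by exact_mod_cast hn
  have hk' : (1 : ℝ) ≤ k := by exact_mod_cast hk
  have hkn' : (k : ℝ) ≤ n := by exact_mod_cast hkn
  have hπ := Real.pi_pos
  have h0 : 0 < h := by rw [hh]; exact div_pos (by linarith) (by linarith)
  have h1 : h ≤ 1 := by rw [hh, div_le_one (by linarith)]; linarith
  have hhn : h * n = (2 * k - 1) / 2 := by rw [hh]; field_simp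
  have hS : MemLp (fun x : Torus => squareWave (n • x)) 2 torusMeasure :=
    MemLp.of_bound (measurable_squareWave_nsmul n).aestronglyMeasurable 1
      (Eventually.of_forall fun _ => (norm_squareWave _).le)
  have key := hasSum_fourierCoeff_mul (memLp_chiPow h m 2) hS
  have key2 := hasSum_int_mul_of_not_dvd key (n := n) (by omega) fun k hk => by
    rw [fourierCoeff_comp_nsmul_of_not_dvd _ (by omega) (by rwa [dvd_neg]), mul_zero]
  have hterm : ∀ l : ℤ, fourierCoeff (chiPow h m) (n * l)
      * fourierCoeff (fun x => squareWave (n • x)) (-(n * l))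
      = ((sinc (π * h * n * l) : ℝ) : ℂ) ^ m * fourierCoeff squareWave l := by
    intro l
    rw [← mul_neg, fourierCoeff_comp_nsmul_mul measurable_squareWave.aestronglyMeasurable
      (by omega), fourierCoeff_squareWave_neg, fourierCoeff_chiPow h _ m hm,
      fourierCoeff_chi h0 h1]
    push_cast
    ring_nf
  simp only [hterm] at key2
  have key3 := hasSum_four_mul_add_one key2
    (fun l hl => by rw [fourierCoeff_squareWave_of_even hl, mul_zero])
    (fun l => by rw [fourierCoeff_squareWave_neg, Int.cast_neg, mul_neg, sinc_neg])
  rw [← key3.tsum_eq]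
  have hterm2 : ∀ j : ℤ, 2 * (((sinc (π * h * n * (4 * j + 1 : ℤ)) : ℝ) : ℂ) ^ m
      * fourierCoeff squareWave (4 * j + 1))
      = ((sin (π * (2 * k - 1) / 2) ^ m / (π * h * n) ^ m * (4 / π)
        * (1 / (4 * (j : ℝ) + 1) ^ (m + 1)) : ℝ) : ℂ) := by
    intro j
    have hj := four_mul_add_one_ne_zero j
    have hs : sinc (π * h * n * (4 * j + 1 : ℤ))
        = sin (π * (2 * k - 1) / 2) / (π * h * n * (4 * j + 1)) := by
      push_cast
      rw [sinc_of_ne_zero (by positivity)]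
      congr 1
      -- Since `hn = (2k-1)/2`, passing from `j = 0` to `j` shifts the argument by `(2k-1)j` full
      -- periods, so the sine is independent of `j`.
      rw [show π * h * n * (4 * (j : ℝ) + 1)
        = π * (2 * k - 1) / 2 + ((2 * k - 1) * j : ℤ) * (2 * π) by
          push_cast
          rw [mul_assoc π h, hhn]
          ring, Real.sin_add_int_mul_two_pi]
    rw [hs, fourierCoeff_squareWave_four_mul_add_one, ← Complex.ofReal_pow, ← Complex.ofReal_mul]
    rw [← Complex.ofReal_ofNat, ← Complex.ofReal_mul]
    congr 1
    rw [div_pow, mul_pow (π * h * n)]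
    field_simp
    ring
  simp only [hterm2]
  rw [← Complex.ofReal_tsum, tsum_mul_left, favard]
  congr 1
  ring

theorem abs_sin_pi_mul_odd_div_two (k : ℕ) : |sin (π * (2 * (k : ℝ) - 1) / 2)| = 1 := by
  rw [show π * (2 * (k : ℝ) - 1) / 2 = k * π - π / 2 by ring, Real.sin_sub_pi_div_two, abs_neg,
    Real.cos_nat_mul_pi, abs_pow]
  simp

theorem favard_div_le_bestApproxL1 {n m k : ℕ} (hn : 1 ≤ n) (hm : 1 ≤ m) (hk : 1 ≤ k)
    (hkn : k ≤ n) {h : ℝ} (hh : h = (2 * (k : ℝ) - 1) / (2 * (n : ℝ))) :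
    ENNReal.ofReal (favard m / (π * h * n) ^ m) ≤ bestApproxL1 (n - 1) (chiPow h m) := by
  refine le_trans ?_ (ofReal_norm_integral_le_bestApproxL1 hn (integrable_chiPow h m))
  rw [integral_chiPow_mul_squareWave hn hm hk hkn hh, Complex.norm_real, Real.norm_eq_abs,
    abs_mul, abs_pow, abs_sin_pi_mul_odd_div_two, one_pow, one_mul]
  exact ENNReal.ofReal_le_ofReal (le_abs_self _)

/-! ### The upper bound by iterated differences -/

/-- The symmetric difference quotient on the circle, iterated. -/
theorem exists_iterated_difference {R : Torus → ℂ} (hR : Integrable R torusMeasure) {h : ℝ}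
    (h0 : 0 < h) (m : ℕ) : ∃ g : Torus → ℂ, Integrable g torusMeasure ∧
      (∀ k : ℤ, fourierCoeff g k = ((sin (π * h * k) / (π * h) : ℝ) : ℂ) ^ m * fourierCoeff R k) ∧
      ∫ x, ‖g x‖ ∂torusMeasure ≤ (∫ x, ‖R x‖ ∂torusMeasure) / (π * h) ^ m := by
  have hπh : 0 < π * h := mul_pos Real.pi_pos h0
  induction m with
  | zero => exact ⟨R, hR, by simp, by simp⟩
  | succ m ih =>
    obtain ⟨g, hg, hc, hn⟩ := ih
    let a : Torus := ((π * h : ℝ) : Torus)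
    -- With this constant the difference of the shifts by `±πh` has symbol `sin(πhk)/(πh)`. The two
    -- shifts together cost a factor `2‖c‖ = 1/(πh)` in norm.
    let c : ℂ := (2 * (π * h : ℝ) * Complex.I)⁻¹
    have hcn : ‖c‖ = (2 * (π * h))⁻¹ := by
      simp only [c, norm_inv, norm_mul, Complex.norm_I, Complex.norm_ofNat, mul_one,
        Complex.norm_real, Real.norm_of_nonneg Real.pi_pos.le, Real.norm_of_nonneg h0.le,
        Complex.ofReal_mul]
    have hi1 : Integrable (fun x => g (x + a)) torusMeasure := hg.comp_add_right a
    have hi2 : Integrable (fun x => g (x + -a)) torusMeasure := hg.comp_add_right (-a)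
    refine ⟨c • (fun x => g (x + a)) + (-c) • (fun x => g (x + -a)),
      (hi1.smul c).add (hi2.smul (-c)), fun k => ?_, ?_⟩
    · rw [fourierCoeff.add (hi1.smul c) (hi2.smul (-c)), Pi.add_apply, fourierCoeff.const_smul,
        fourierCoeff.const_smul, fourierCoeff_comp_add_right, fourierCoeff_comp_add_right, hc,
        show -a = ((-(π * h) : ℝ) : Torus) from rfl, fourier_coe, fourier_coe]
      have h1 : (π : ℂ) ≠ 0 := by exact_mod_cast Real.pi_ne_zero
      have h2 : (h : ℂ) ≠ 0 := by exact_mod_cast h0.ne'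
      rw [pow_succ]
      simp only [c, smul_eq_mul]
      push_cast
      rw [Complex.sin, show (k : ℂ) * Complex.I * (π * h) = π * h * k * Complex.I by ring,
        show (k : ℂ) * Complex.I * -(π * h) = -(π * h * k) * Complex.I by ring]
      field_simp
      rw [Complex.I_sq]
      ring
    · have e1 := integral_add_right_eq_self (μ := (torusMeasure : Measure Torus))
        (fun x => ‖g x‖) a
      have e2 := integral_add_right_eq_self (μ := (torusMeasure : Measure Torus))
        (fun x => ‖g x‖) (-a)
      calc ∫ x, ‖(c • (fun x => g (x + a)) + (-c) • (fun x => g (x + -a))) x‖ ∂torusMeasure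
          ≤ ∫ x, (‖c‖ * ‖g (x + a)‖ + ‖c‖ * ‖g (x + -a)‖) ∂torusMeasure := by
            refine integral_mono ((hi1.smul c).add (hi2.smul (-c))).norm
              ((hi1.norm.const_mul _).add (hi2.norm.const_mul _)) fun x => ?_
            refine (norm_add_le _ _).trans (le_of_eq ?_)
            simp
        _ = (∫ x, ‖g x‖ ∂torusMeasure) / (π * h) := by
            rw [integral_add (hi1.norm.const_mul _) (hi2.norm.const_mul _), integral_const_mul,
              integral_const_mul, e1, e2, hcn]
            field_simp
            ring
        _ ≤ _ := by
            rw [pow_succ, ← div_div _ ((π * h) ^ m)]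
            exact div_le_div_of_nonneg_right hn hπh.le

theorem const_mem_trigPoly (d : ℕ) (c : ℂ) : (fun _ => c) ∈ trigPoly d := by
  refine ⟨fun k => if k = 0 then c else 0, fun φ => ?_⟩
  rw [Finset.sum_eq_single 0]
  · simp
  · intro k _ hk
    simp [hk]
  · intro h
    simp at h

/-- No point of the circle has norm above `π`, so the cutoff is invisible for `h ≥ 1`. This range is
separate because `fourierCoeff_chi` requires `h ≤ 1`. -/
theorem chiPow_eq_const {h : ℝ} (h1 : 1 ≤ h) : ∀ m : ℕ, ∃ c : ℂ, chiPow h m = fun _ => c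
  | 0 => ⟨0, rfl⟩
  | 1 => by
    refine ⟨((h⁻¹ : ℝ) : ℂ), funext fun x => ?_⟩
    have h2 := AddCircle.norm_le_half_period (2 * π) (x := x) Real.two_pi_pos.ne'
    rw [abs_of_pos Real.two_pi_pos] at h2
    have hx : x ∈ {θ : Torus | ‖θ‖ ≤ π * h} := show ‖x‖ ≤ π * h by nlinarith [Real.pi_pos]
    exact Set.indicator_of_mem hx (fun _ => ((h⁻¹ : ℝ) : ℂ))
  | m + 2 => by
    obtain ⟨c, hc⟩ := chiPow_eq_const h1 (m + 1)
    refine ⟨(∫ t, chi h t ∂torusMeasure) * c, funext fun x => ?_⟩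
    simp only [chiPow, hc, conv, convolution_def, ContinuousLinearMap.mul_apply']
    rw [integral_mul_const]

theorem bestApproxL1_const (d : ℕ) (c : ℂ) : bestApproxL1 d (fun _ => c) = 0 := by
  refine le_antisymm ((iInf₂_le _ (const_mem_trigPoly d c)).trans ?_) zero_le
  simp

/-- A function with the Fourier coefficients `k ^ (-m)` of a Bernoulli kernel beyond degree `n - 1`
yields an upper bound for the best approximation of `χ_h^m`. -/
theorem bestApproxL1_chiPow_le {n m : ℕ} (hn : 1 ≤ n) (hm : 1 ≤ m) {h K : ℝ} (h0 : 0 < h)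
    {R : Torus → ℂ} (hR : Integrable R torusMeasure)
    (hRc : ∀ k : ℤ, (n : ℤ) ≤ |k| → fourierCoeff R k = 1 / (k : ℂ) ^ m)
    (hRn : ∫ x, ‖R x‖ ∂torusMeasure ≤ K / n ^ m) :
    bestApproxL1 (n - 1) (chiPow h m) ≤ ENNReal.ofReal (K / (π * h * n) ^ m) := by
  rcases le_or_gt 1 h with h1 | h1
  · obtain ⟨c, hc⟩ := chiPow_eq_const h1 m
    rw [hc, bestApproxL1_const]
    exact zero_le
  · obtain ⟨g, hg, hgc, hgn⟩ := exists_iterated_difference hR h0 m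
    have hπh : 0 < π * h := mul_pos Real.pi_pos h0
    refine (bestApproxL1_le_of_fourierCoeff_eq (integrable_chiPow h m) hg fun k hk => ?_).trans ?_
    · have hk0 : k ≠ 0 := by rintro rfl; simp at hk; omega
      have hkr : (k : ℝ) ≠ 0 := by exact_mod_cast hk0
      rw [hgc, hRc k (by omega), fourierCoeff_chiPow h k m hm, fourierCoeff_chi h0 h1.le,
        sinc_of_ne_zero (by positivity)]
      rw [mul_one_div, ← div_pow]
      push_cast
      rw [div_div]
    · rw [eLpNorm_one_eq_lintegral_enorm, ← ofReal_integral_norm_eq_lintegral_enorm hg]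
      refine ENNReal.ofReal_le_ofReal (hgn.trans ?_)
      rw [mul_pow (π * h), mul_comm ((π * h) ^ m), ← div_div K]
      exact div_le_div_of_nonneg_right hRn (by positivity)

/-! ### The Poisson kernel -/

/-- The Poisson kernel of radius `e ^ (-u)`. -/
def poisson (u : ℝ) (x : Torus) : ℝ :=
  (1 - rexp (-u) ^ 2) / ‖1 - (rexp (-u) : ℂ) * fourier 1 x‖ ^ 2

theorem poisson_nonneg {u : ℝ} (hu : 0 < u) (x : Torus) : 0 ≤ poisson u x := by
  have h1 : rexp (-u) ≤ 1 := Real.exp_le_one_iff.2 (by linarith)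
  have h2 : rexp (-u) ^ 2 ≤ 1 := pow_le_one₀ (Real.exp_pos _).le h1
  exact div_nonneg (by linarith) (by positivity)

theorem fourier_natCast (n : ℕ) (x : Torus) : (fourier (n : ℤ) x : ℂ) = fourier 1 x ^ n := by
  induction n with
  | zero => simp only [Nat.cast_zero, fourier_zero, pow_zero]
  | succ n ih => rw [Nat.cast_succ, fourier_add, ih, pow_succ]

theorem norm_exp_mul_fourier (u : ℝ) (x : Torus) :
    ‖(rexp (-u) : ℂ) * fourier 1 x‖ = rexp (-u) := by
  rw [norm_mul, norm_fourier_apply, mul_one, Complex.norm_real, Real.norm_of_nonneg]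
  exact (Real.exp_pos _).le

theorem one_sub_exp_mul_fourier_ne_zero {u : ℝ} (hu : 0 < u) (x : Torus) :
    1 - (rexp (-u) : ℂ) * fourier 1 x ≠ 0 := by
  intro h
  have h1 := norm_exp_mul_fourier u x
  rw [← sub_eq_zero.1 h, norm_one] at h1
  have := (Real.exp_lt_one_iff (x := -u)).2 (by linarith)
  linarith

/-- Two geometric series, in `z` over `k ≥ 0` and in its conjugate over `k < 0`, added over the
common denominator `|1 - z|²`. -/
theorem hasSum_geometric_add_conj {z : ℂ} (hz : ‖z‖ < 1) {f : ℤ → ℂ}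
    (hp : ∀ n : ℕ, f n = z ^ n) (hm : ∀ n : ℕ, f (-(n + 1)) = (starRingEnd ℂ) z ^ (n + 1)) :
    HasSum f (((1 - ‖z‖ ^ 2) / ‖1 - z‖ ^ 2 : ℝ) : ℂ) := by
  have hc : ‖(starRingEnd ℂ) z‖ < 1 := by rwa [RCLike.norm_conj]
  have h1 : 1 - z ≠ 0 := by
    intro h
    rw [← sub_eq_zero.1 h, norm_one] at hz
    exact lt_irrefl _ hz
  have h2 : 1 - (starRingEnd ℂ) z ≠ 0 := by
    rw [← map_one (starRingEnd ℂ), ← map_sub]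
    exact (map_ne_zero _).2 h1
  have h3 : ((‖1 - z‖ ^ 2 : ℝ) : ℂ) = (1 - z) * (1 - (starRingEnd ℂ) z) := by
    rw [← Complex.normSq_eq_norm_sq, ← Complex.mul_conj, map_sub, map_one]
  have h4 : ((‖z‖ ^ 2 : ℝ) : ℂ) = z * (starRingEnd ℂ) z := by
    rw [Complex.mul_conj, Complex.normSq_eq_norm_sq]
  have h5 : (((1 - ‖z‖ ^ 2) / ‖1 - z‖ ^ 2 : ℝ) : ℂ)
      = (1 - z)⁻¹ + (starRingEnd ℂ) z * (1 - (starRingEnd ℂ) z)⁻¹ := by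
    rw [Complex.ofReal_div, h3, Complex.ofReal_sub, h4, Complex.ofReal_one]
    field_simp
    ring
  rw [h5]
  refine HasSum.of_nat_of_neg_add_one ?_ ?_
  · simp only [hp]
    exact hasSum_geometric_of_norm_lt_one hz
  · simp only [hm, pow_succ']
    exact (hasSum_geometric_of_norm_lt_one hc).mul_left _

theorem exp_mul_fourier_natCast (u : ℝ) (x : Torus) (n : ℕ) :
    ((rexp (-u * |((n : ℤ) : ℝ)|) : ℝ) : ℂ) * fourier (n : ℤ) x
      = ((rexp (-u) : ℂ) * fourier 1 x) ^ n := by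
  rw [fourier_natCast, mul_pow, Int.cast_natCast, abs_of_nonneg n.cast_nonneg, mul_comm (-u),
    Real.exp_nat_mul, Complex.ofReal_pow]

theorem hasSum_poisson {u : ℝ} (hu : 0 < u) (x : Torus) :
    HasSum (fun k : ℤ => ((rexp (-u * |(k : ℝ)|) : ℝ) : ℂ) * fourier k x) (poisson u x : ℂ) := by
  have h := norm_exp_mul_fourier u x
  have key := hasSum_geometric_add_conj (z := (rexp (-u) : ℂ) * fourier 1 x)
    (f := fun k : ℤ => ((rexp (-u * |(k : ℝ)|) : ℝ) : ℂ) * fourier k x)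
    (by rw [h]; exact Real.exp_lt_one_iff.2 (by linarith)) (exp_mul_fourier_natCast u x)
    fun n => by
      rw [← map_pow, ← exp_mul_fourier_natCast u x (n + 1), map_mul, Complex.conj_ofReal,
        fourier_neg, Nat.cast_succ, Int.cast_neg, abs_neg]
  rw [h] at key
  exact key

theorem continuous_poisson {u : ℝ} (hu : 0 < u) : Continuous (poisson u) := by
  unfold poisson
  refine Continuous.div (by fun_prop) (by fun_prop) fun x => ?_
  exact pow_ne_zero 2 (norm_ne_zero_iff.2 (one_sub_exp_mul_fourier_ne_zero hu x))

theorem summable_exp_neg_mul_abs {u : ℝ} (hu : 0 < u) :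
    Summable fun k : ℤ => rexp (-u * |(k : ℝ)|) := by
  have := (hasSum_poisson hu 0).summable
  simp only [fourier_eval_zero, mul_one] at this
  exact_mod_cast this

theorem fourierCoeff_of_hasSum_norm {c : ℤ → ℂ} (hc : Summable fun k => ‖c k‖) {f : Torus → ℂ}
    (hf : ∀ x, HasSum (fun k : ℤ => c k * fourier k x) (f x)) (k : ℤ) : fourierCoeff f k = c k := by
  have hint : ∀ j : ℤ, Integrable (fun x : Torus => (fourier (-k) x : ℂ) * (c j * fourier j x))
      torusMeasure := fun j => integrable_of_continuous (by fun_prop)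
  have h := hasSum_integral_of_summable_integral_norm hint (by
    simpa only [norm_mul, norm_fourier_apply, one_mul, mul_one, integral_const, probReal_univ,
      one_smul] using hc)
  have h2 : ∀ j : ℤ, ∫ x : Torus, (fourier (-k) x : ℂ) * (c j * fourier j x) ∂torusMeasure
      = if j = k then c k else 0 := by
    intro j
    have h3 := fourierCoeff.const_mul (fourier j : Torus → ℂ) (c j) k
    rw [fourierCoeff_fourier, Pi.single_apply] at h3
    refine h3.trans ?_
    by_cases hjk : j = k
    · simp [hjk]
    · simp [hjk, Ne.symm hjk]
  rw [funext h2] at h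
  refine Eq.trans ?_ (h.unique (hasSum_ite_eq k (c k)))
  simp only [fourierCoeff, smul_eq_mul]
  refine integral_congr_ae (Eventually.of_forall fun x => ?_)
  exact ((hf x).mul_left _).tsum_eq.symm

theorem fourierCoeff_poisson {u : ℝ} (hu : 0 < u) (k : ℤ) :
    fourierCoeff (fun x => (poisson u x : ℂ)) k = ((rexp (-u * |(k : ℝ)|) : ℝ) : ℂ) := by
  refine fourierCoeff_of_hasSum_norm (c := fun k : ℤ => ((rexp (-u * |(k : ℝ)|) : ℝ) : ℂ)) ?_
    (hasSum_poisson hu) k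
  simpa only [Complex.norm_real, norm_eq_abs, Real.abs_exp] using summable_exp_neg_mul_abs hu

/-! ### The interpolation remainder for a fixed Laplace parameter -/

/-- The error of interpolating the (conjugate, if `ε = -1`) Poisson kernel by trigonometric
polynomials of degree less than `n` at the zeros of `cos nθ` (of `sin nθ`, if `ε = -1`). -/
def remainder (n : ℕ) (ε u : ℝ) (x : Torus) : ℂ :=
  (fourier n x + ε * fourier (-n) x)
    * ((poisson u x / (rexp (u * n) + ε * rexp (-u * n)) : ℝ) : ℂ)

theorem remainder_denominator_pos {n : ℕ} (hn : 1 ≤ n) {ε u : ℝ} (hε : ε = 1 ∨ ε = -1)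
    (hu : 0 < u) : 0 < rexp (u * n) + ε * rexp (-u * n) := by
  have hn' : (0 : ℝ) < n := by exact_mod_cast hn
  rcases hε with rfl | rfl
  · positivity
  · have : rexp (-u * n) < rexp (u * n) := Real.exp_lt_exp.2 (by nlinarith)
    linarith

theorem continuous_remainder (n : ℕ) (ε : ℝ) {u : ℝ} (hu : 0 < u) :
    Continuous (remainder n ε u) := by
  have := continuous_poisson hu
  unfold remainder
  fun_prop

theorem measurable_remainder (n : ℕ) (ε : ℝ) :
    Measurable fun p : ℝ × Torus => remainder n ε p.1 p.2 := by
  have h : ∀ k : ℤ, Measurable fun p : ℝ × Torus => (fourier k p.2 : ℂ) := fun k =>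
    (fourier k).continuous.measurable.comp measurable_snd
  have h0 := h n
  have h1 := h (-n)
  have h2 := h 1
  unfold remainder poisson
  fun_prop

theorem fourierCoeff_fourier_mul (f : Torus → ℂ) (a k : ℤ) :
    fourierCoeff (fun x => fourier a x * f x) k = fourierCoeff f (k - a) := by
  simp only [fourierCoeff, smul_eq_mul, ← mul_assoc, ← fourier_add]
  rw [neg_sub, neg_add_eq_sub]

/-- For `|k| ≥ n` the shifts `k - n` and `k + n` do not straddle zero, so `e^(-u|k|)` factors out of
both Poisson coefficients. What is left is the denominator `D` when `k > 0`, and `ε D` when `k < 0`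
because `ε² = 1`. -/
theorem fourierCoeff_remainder {n : ℕ} (hn : 1 ≤ n) {ε u : ℝ} (hε : ε = 1 ∨ ε = -1)
    (hu : 0 < u) {k : ℤ} (hk : (n : ℤ) ≤ |k|) :
    fourierCoeff (remainder n ε u) k
      = (((if 0 < k then 1 else ε) * rexp (-u * |(k : ℝ)|) : ℝ) : ℂ) := by
  have hD := (remainder_denominator_pos hn hε hu).ne'
  set D := rexp (u * n) + ε * rexp (-u * n) with hDdef
  have hDc : (D : ℂ) ≠ 0 := by exact_mod_cast hD
  have hP := integrable_of_continuous (Complex.continuous_ofReal.comp (continuous_poisson hu))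
  have hP1 : Integrable (fun x => (fourier (n : ℤ) x : ℂ) * poisson u x) torusMeasure :=
    hP.fourier_smul n
  have hP2 : Integrable (fun x => (fourier (-n : ℤ) x : ℂ) * poisson u x) torusMeasure :=
    hP.fourier_smul (-n)
  have h1 : remainder n ε u = ((D : ℂ)⁻¹ • fun x => (fourier (n : ℤ) x : ℂ) * poisson u x)
      + ((ε / D : ℂ) • fun x => (fourier (-n : ℤ) x : ℂ) * poisson u x) := by
    funext x
    simp only [remainder, ← hDdef, Pi.add_apply, Pi.smul_apply, smul_eq_mul]
    push_cast
    field_simp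
  rw [h1, fourierCoeff.add (hP1.smul _) (hP2.smul _), Pi.add_apply, fourierCoeff.const_smul,
    fourierCoeff.const_smul, fourierCoeff_fourier_mul, fourierCoeff_fourier_mul,
    fourierCoeff_poisson hu, fourierCoeff_poisson hu]
  simp only [smul_eq_mul]
  rw [← Complex.ofReal_inv, ← Complex.ofReal_div, ← Complex.ofReal_mul, ← Complex.ofReal_mul,
    ← Complex.ofReal_add]
  congr 1
  push_cast
  have hn0 : (0 : ℝ) < n := by exact_mod_cast hn
  have hε2 : ε * ε = 1 := by rcases hε with rfl | rfl <;> norm_num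
  split_ifs with h0
  · have hkn : (n : ℝ) ≤ k := by
      rw [abs_of_pos h0] at hk
      exact_mod_cast hk
    rw [abs_of_nonneg (by linarith : (0 : ℝ) ≤ k - n),
      abs_of_nonneg (by linarith : (0 : ℝ) ≤ k - -n), abs_of_nonneg (by linarith : (0 : ℝ) ≤ k)]
    rw [show -u * ((k : ℝ) - n) = -u * k + u * n by ring,
      show -u * ((k : ℝ) - -n) = -u * k + -u * n by ring, Real.exp_add, Real.exp_add]
    field_simp
    rw [hDdef]
    ring_nf
  · have hkn : (k : ℝ) ≤ -n := by
      rw [abs_of_nonpos (by omega)] at hk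
      have : k ≤ -(n : ℤ) := by omega
      exact_mod_cast this
    rw [abs_of_nonpos (by linarith : (k : ℝ) - n ≤ 0),
      abs_of_nonpos (by linarith : (k : ℝ) - -n ≤ 0), abs_of_nonpos (by linarith : (k : ℝ) ≤ 0)]
    rw [show -u * -((k : ℝ) - n) = -u * -k + -u * n by ring,
      show -u * -((k : ℝ) - -n) = -u * -k + u * n by ring, Real.exp_add, Real.exp_add]
    field_simp
    rw [hDdef]
    rw [neg_mul]
    linear_combination (-rexp (-(u * n))) * hε2

/-! ### The norm of the remainder through its sign wave -/

theorem norm_fourier_one_add_fourier_neg_one (y : Torus) :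
    ((‖(fourier 1 y + fourier (-1) y : ℂ)‖ : ℝ) : ℂ)
      = (fourier 1 y + fourier (-1) y) * squareWave y := by
  obtain ⟨θ, hθ, rfl⟩ : ∃ θ ∈ Set.Ioc (-π) (-π + 2 * π), (θ : Torus) = y :=
    ⟨_, (AddCircle.equivIoc (2 * π) (-π) y).2, AddCircle.coe_equivIoc⟩
  have habs : |θ| ≤ π := abs_le.2 ⟨hθ.1.le, by linarith [hθ.2]⟩
  have h1 : ‖(θ : Torus)‖ = |θ| := by
    rw [AddCircle.norm_coe_eq_abs_iff _ Real.two_pi_pos.ne', abs_of_pos Real.two_pi_pos]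
    linarith
  have h2 : (fourier 1 (θ : Torus) + fourier (-1) (θ : Torus) : ℂ) = ((2 * cos θ : ℝ) : ℂ) := by
    rw [fourier_coe, fourier_coe]
    push_cast
    rw [Complex.cos]
    ring_nf
  rw [h2, squareWave_apply, h1, Complex.norm_real, Real.norm_eq_abs, ← Real.cos_abs θ]
  split_ifs with h
  · rw [abs_of_nonneg, mul_one]
    have := Real.cos_nonneg_of_mem_Icc ⟨by linarith [abs_nonneg θ, Real.pi_pos], h⟩
    linarith
  · rw [abs_of_nonpos]
    · push_cast
      ring
    · have := Real.cos_nonpos_of_pi_div_two_le_of_le (not_le.1 h).le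
        (by linarith [Real.pi_pos] : |θ| ≤ π + π / 2)
      linarith

/-- The unimodular function carrying the sign of `cos` (for `ε = 1`) or `sin` (for `ε = -1`). -/
theorem exists_signWave {ε : ℝ} (hε : ε = 1 ∨ ε = -1) : ∃ W : Torus → ℂ, Measurable W ∧
    (∀ y, ‖W y‖ = 1) ∧
    (∀ y, ((‖(fourier 1 y + ε * fourier (-1) y : ℂ)‖ : ℝ) : ℂ)
      = (fourier 1 y + ε * fourier (-1) y) * W y) ∧
    (∀ l, Even l → fourierCoeff W l = 0) ∧
    (∀ l, fourierCoeff W (-l) = ε * fourierCoeff W l) ∧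
    ∀ j : ℤ, fourierCoeff W (-(4 * j + 1)) = ((2 / (π * (4 * j + 1)) : ℝ) : ℂ) := by
  rcases hε with rfl | rfl
  · refine ⟨squareWave, measurable_squareWave, norm_squareWave, fun y => ?_,
      fun l => fourierCoeff_squareWave_of_even, fun l => ?_, fun j => ?_⟩
    · simpa only [Complex.ofReal_one, one_mul] using norm_fourier_one_add_fourier_neg_one y
    · rw [fourierCoeff_squareWave_neg, Complex.ofReal_one, one_mul]
    · rw [fourierCoeff_squareWave_neg, fourierCoeff_squareWave_four_mul_add_one]
  · let a : Torus := ((-(π / 2) : ℝ) : Torus)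
    have hπ : ∀ c : ℂ, c * ((-(π / 2) : ℝ) : ℂ) = -(c * (π / 2)) := fun c => by push_cast; ring
    have ha1 : (fourier 1 a : ℂ) = -Complex.I := by
      rw [fourier_coe, hπ, Int.cast_one, one_mul, mul_comm, Complex.exp_neg,
        Complex.exp_pi_div_two_mul_I, Complex.inv_I]
    have ha2 : (fourier (-1) a : ℂ) = Complex.I := by
      rw [fourier_neg, ha1, map_neg, Complex.conj_I, neg_neg]
    have hcoef : ∀ l, fourierCoeff (fun y => -Complex.I * squareWave (y + a)) l
        = -Complex.I * (fourier l a * fourierCoeff squareWave l) := fun l => by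
      rw [fourierCoeff.const_mul, fourierCoeff_comp_add_right]
    have hadd : ∀ (k : ℤ) (x y : Torus), (fourier k (x + y) : ℂ) = fourier k x * fourier k y := by
      intro k x y
      simp only [fourier_apply, smul_add, toCircle_add, Circle.coe_mul]
    refine ⟨fun y => -Complex.I * squareWave (y + a), ?_, fun y => ?_, fun y => ?_,
      fun l hl => ?_, fun l => ?_, fun j => ?_⟩
    · exact (measurable_squareWave.comp (measurable_add_const a)).const_mul _
    · rw [norm_mul, norm_neg, Complex.norm_I, norm_squareWave, one_mul]
    · have h := norm_fourier_one_add_fourier_neg_one (y + a)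
      have h1 : (fourier 1 (y + a) + fourier (-1) (y + a) : ℂ)
          = -Complex.I * (fourier 1 y + ((-1 : ℝ) : ℂ) * fourier (-1) y) := by
        rw [hadd, hadd, ha1, ha2]
        push_cast
        ring
      rw [h1, norm_mul, norm_neg, Complex.norm_I, one_mul] at h
      rw [h]
      ring
    · rw [hcoef, fourierCoeff_squareWave_of_even hl]
      ring
    · rw [hcoef, hcoef, fourierCoeff_squareWave_neg]
      rcases Int.even_or_odd l with hl | ⟨j, rfl⟩
      · rw [fourierCoeff_squareWave_of_even hl]
        ring
      · have h2 : (fourier (2 * j + 1) a : ℂ) ^ 2 = -1 := by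
          rw [fourier_coe, ← Complex.exp_nat_mul, Complex.exp_eq_exp_iff_exists_int.2 ⟨-j - 1, ?_⟩,
            Complex.exp_pi_mul_I]
          push_cast
          ring
        have h3 : (fourier (-(2 * j + 1)) a : ℂ) = -fourier (2 * j + 1) a := by
          have h4 : (fourier (-(2 * j + 1)) a : ℂ) * fourier (2 * j + 1) a = 1 := by
            rw [← fourier_add, neg_add_cancel, fourier_zero]
          have h5 : (fourier (2 * j + 1) a : ℂ) ≠ 0 := fun h => by
            rw [h, mul_zero] at h4
            exact zero_ne_one h4
          refine mul_right_cancel₀ h5 ?_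
          rw [h4]
          linear_combination h2
        rw [h3]
        push_cast
        ring
    · rw [hcoef, fourierCoeff_squareWave_neg, fourierCoeff_squareWave_four_mul_add_one]
      have h2 : (fourier (-(4 * j + 1)) a : ℂ) = Complex.I := by
        rw [← Complex.exp_pi_div_two_mul_I, fourier_coe, Complex.exp_eq_exp_iff_exists_int]
        refine ⟨j, ?_⟩
        push_cast
        ring
      rw [h2, ← mul_assoc, neg_mul, Complex.I_mul_I]
      ring

/-- Pairing with `W (n • x)` sees only frequencies `nl` with `l` odd. These satisfy `|nl| ≥ n`, so
the unknown low coefficients of the remainder never enter. -/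
theorem hasSum_integral_norm_remainder {n : ℕ} (hn : 1 ≤ n) (m : ℕ) {u : ℝ} (hu : 0 < u) :
    HasSum (fun j : ℤ => 4 / π * ((if (0 : ℝ) < 4 * j + 1 then 1 else (-1) ^ m)
      * rexp (-u * (n * |4 * (j : ℝ) + 1|)) / (4 * j + 1)))
      (∫ x, ‖remainder n ((-1) ^ m) u x‖ ∂torusMeasure) := by
  have hε : ((-1) ^ m : ℝ) = 1 ∨ ((-1) ^ m : ℝ) = -1 := neg_one_pow_eq_or ℝ m
  set ε : ℝ := (-1) ^ m
  obtain ⟨W, hWm, hW1, hWn, hW0, hWneg, hWj⟩ := exists_signWave hε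
  have hn' : (0 : ℝ) < n := by exact_mod_cast hn
  have hε2 : (ε : ℂ) * ε = 1 := by
    rcases hε with h | h <;> rw [h] <;> norm_num
  have hnorm : ∀ x, ((‖remainder n ε u x‖ : ℝ) : ℂ) = remainder n ε u x * W (n • x) := by
    intro x
    have h1 : ∀ k : ℤ, (fourier (k * n) x : ℂ) = fourier k (n • x) := fun k => by
      simp only [fourier_apply, ← natCast_zsmul x n, smul_smul]
    have h2 := h1 1
    have h3 := h1 (-1)
    rw [one_mul] at h2
    rw [neg_one_mul] at h3
    simp only [remainder]
    rw [h2, h3, norm_mul, Complex.ofReal_mul, hWn, Complex.norm_real, Real.norm_of_nonneg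
      (div_nonneg (poisson_nonneg hu x) (remainder_denominator_pos hn hε hu).le)]
    ring
  have hWnm : Measurable fun x : Torus => W (n • x) :=
    hWm.comp (by fun_prop : Continuous fun x : Torus => n • x).measurable
  have hW2 : MemLp (fun x : Torus => W (n • x)) 2 torusMeasure :=
    MemLp.of_bound hWnm.aestronglyMeasurable 1 (Eventually.of_forall fun _ => (hW1 _).le)
  have hQ2 : MemLp (remainder n ε u) 2 torusMeasure :=
    (continuous_remainder n ε hu).memLp_of_hasCompactSupport (HasCompactSupport.of_compactSpace _)
  have key := hasSum_fourierCoeff_mul hQ2 hW2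
  have key2 := hasSum_int_mul_of_not_dvd key (n := n) (by omega) fun k hk => by
    rw [fourierCoeff_comp_nsmul_of_not_dvd _ (by omega) (by rwa [dvd_neg]), mul_zero]
  have hWc : ∀ l : ℤ, fourierCoeff (fun x => W (n • x)) (-(n * l)) = fourierCoeff W (-l) := by
    intro l
    rw [← mul_neg, fourierCoeff_comp_nsmul_mul hWm.aestronglyMeasurable (by omega)]
  simp only [hWc] at key2
  have hnl : ∀ l : ℤ, l ≠ 0 → (n : ℤ) ≤ |n * l| := fun l hl => by
    rw [abs_mul, Nat.abs_cast]
    exact le_mul_of_one_le_right (by omega) (Int.one_le_abs hl)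
  have key3 := hasSum_four_mul_add_one key2
    (fun l hl => by rw [hW0 (-l) hl.neg, mul_zero])
    -- Under `l ↦ -l` both factors change by `ε`, and `ε² = 1`. The index `l = 0`, outside the
    -- coefficient formula, is trivially symmetric.
    (fun l => by
      rcases eq_or_ne l 0 with rfl | hl
      · simp
      · have hl' : -l ≠ 0 := neg_ne_zero.2 hl
        rw [fourierCoeff_remainder hn hε hu (hnl l hl),
          fourierCoeff_remainder hn hε hu (hnl (-l) hl'), neg_neg, hWneg l]
        have hpos : (0 : ℤ) < n := by omega
        rcases lt_or_gt_of_ne hl with h | h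
        · rw [if_pos (by nlinarith), if_neg (by nlinarith)]
          push_cast
          rw [mul_neg, abs_neg]
          linear_combination (-Complex.exp (-(u : ℂ) * ((|(n : ℝ) * l| : ℝ) : ℂ))
            * fourierCoeff W l) * hε2
        · rw [if_neg (by nlinarith), if_pos (by nlinarith)]
          push_cast
          rw [mul_neg, abs_neg]
          ring)
  have hI : ∫ x, remainder n ε u x * W (n • x) ∂torusMeasure
      = ((∫ x, ‖remainder n ε u x‖ ∂torusMeasure : ℝ) : ℂ) := by
    rw [← integral_complex_ofReal]
    exact integral_congr_ae (Eventually.of_forall fun x => (hnorm x).symm)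
  rw [hI] at key3
  rw [← Complex.hasSum_ofReal]
  convert! key3 using 2 with j
  have hj := four_mul_add_one_ne_zero j
  have hj0 : 4 * j + 1 ≠ 0 := by omega
  rw [hWj, fourierCoeff_remainder hn hε hu (hnl _ hj0), ← Complex.ofReal_ofNat,
    ← Complex.ofReal_mul, ← Complex.ofReal_mul]
  congr 1
  have hif : (0 < (n : ℤ) * (4 * j + 1)) ↔ (0 : ℝ) < 4 * j + 1 := by
    rw [mul_pos_iff_of_pos_left (by omega : (0 : ℤ) < n)]
    exact_mod_cast Iff.rfl
  simp only [hif]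
  push_cast
  rw [abs_mul, Nat.abs_cast]
  have hπ := Real.pi_pos.ne'
  field_simp
  ring

/-! ### Laplace superposition and Favard's constant -/

/-- The density representing `a ^ (-m)` as a Laplace transform. -/
def laplaceWeight (m : ℕ) (u : ℝ) : ℝ := u ^ (m - 1) / (m - 1).factorial

theorem laplaceWeight_nonneg (m : ℕ) {u : ℝ} (hu : 0 < u) : 0 ≤ laplaceWeight m u := by
  unfold laplaceWeight
  positivity

theorem continuous_laplaceWeight (m : ℕ) : Continuous (laplaceWeight m) := by
  unfold laplaceWeight
  fun_prop

theorem integral_laplaceWeight {m : ℕ} (hm : 1 ≤ m) {a : ℝ} (ha : 0 < a) :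
    ∫ u in Set.Ioi 0, laplaceWeight m u * rexp (-u * a) = 1 / a ^ m := by
  have hm0 : (0 : ℝ) < m := by exact_mod_cast hm
  have hcast : (m : ℝ) - 1 = ((m - 1 : ℕ) : ℝ) := by push_cast [hm]; ring
  have h := Real.integral_rpow_mul_exp_neg_mul_Ioi hm0 ha
  have hG : Real.Gamma m = ((m - 1).factorial : ℝ) := by
    rw [← Real.Gamma_nat_eq_factorial, ← hcast, sub_add_cancel]
  have hf : ((m - 1).factorial : ℝ) ≠ 0 := by positivity
  have h2 : ∀ u : ℝ, laplaceWeight m u * rexp (-u * a)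
      = ((m - 1).factorial : ℝ)⁻¹ * (u ^ ((m : ℝ) - 1) * rexp (-(a * u))) := by
    intro u
    rw [laplaceWeight, hcast, Real.rpow_natCast, show -u * a = -(a * u) by ring]
    field_simp
  simp only [h2]
  rw [integral_const_mul, h, hG, Real.rpow_natCast, one_div_pow]
  field_simp

theorem integrableOn_laplaceWeight {m : ℕ} (hm : 1 ≤ m) {a : ℝ} (ha : 0 < a) :
    IntegrableOn (fun u => laplaceWeight m u * rexp (-u * a)) (Set.Ioi 0) := by
  -- The integral of a non-integrable function is `0` by convention, so the positive value just
  -- computed forces integrability.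
  refine Integrable.of_integral_ne_zero ?_
  rw [integral_laplaceWeight hm ha]
  positivity

theorem integrable_tsum_of_summable_integral_norm {α : Type*} [MeasurableSpace α] {μ : Measure α}
    {ι : Type*} [Countable ι] {F : ι → α → ℝ} (hF : ∀ i, Integrable (F i) μ)
    (hs : Summable fun i => ∫ a, ‖F i a‖ ∂μ) {G : α → ℝ} (hG : AEStronglyMeasurable G μ)
    (hFG : ∀ᵐ a ∂μ, HasSum (fun i => F i a) (G a)) : Integrable G μ := by
  refine ⟨hG, ?_⟩
  have h1 : ∫⁻ a, ‖G a‖ₑ ∂μ ≤ ∫⁻ a, ∑' i, ‖F i a‖ₑ ∂μ := by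
    refine lintegral_mono_ae ?_
    filter_upwards [hFG] with a ha
    rw [← ha.tsum_eq]
    exact enorm_tsum_le_tsum_enorm
  refine lt_of_le_of_lt h1 ?_
  rw [lintegral_tsum fun i => (hF i).1.enorm]
  simp only [← ofReal_integral_norm_eq_lintegral_enorm (hF _)]
  exact hs.tsum_ofReal_lt_top

/-- Termwise integration of the norm series is justified by the convergence of `∑ |4j+1|^(-(m+1))`,
which needs `m ≥ 1`. -/
theorem integral_laplaceWeight_mul_integral_norm_remainder {n m : ℕ} (hn : 1 ≤ n) (hm : 1 ≤ m) :
    IntegrableOn (fun u => laplaceWeight m u * ∫ x, ‖remainder n ((-1) ^ m) u x‖ ∂torusMeasure)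
      (Set.Ioi 0) ∧
    ∫ u in Set.Ioi 0, laplaceWeight m u * ∫ x, ‖remainder n ((-1) ^ m) u x‖ ∂torusMeasure
      = favard m / n ^ m := by
  have hn' : (0 : ℝ) < n := by exact_mod_cast hn
  have hπ := Real.pi_pos
  let σ : ℤ → ℝ := fun j => if (0 : ℝ) < 4 * j + 1 then 1 else (-1) ^ m
  let c : ℤ → ℝ := fun j => 4 / π * (σ j / (4 * j + 1))
  let a : ℤ → ℝ := fun j => n * |4 * (j : ℝ) + 1|
  have hσ : ∀ j, |σ j| = 1 := fun j => by
    simp only [σ]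
    split_ifs <;> simp
  have ha : ∀ j, 0 < a j := fun j => mul_pos hn' (abs_pos.2 (four_mul_add_one_ne_zero j))
  let F : ℤ → ℝ → ℝ := fun j u => c j * (laplaceWeight m u * rexp (-u * a j))
  have hFi : ∀ j, Integrable (F j) (volume.restrict (Set.Ioi 0)) := fun j =>
    (integrableOn_laplaceWeight hm (ha j)).const_mul _
  have hFn : ∀ j, ∫ u in Set.Ioi 0, ‖F j u‖
      = 4 / π / n ^ m * |1 / ((4 * j + 1 : ℤ) : ℝ) ^ (m + 1)| := by
    intro j
    have h1 : ∫ u in Set.Ioi 0, ‖F j u‖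
        = ∫ u in Set.Ioi 0, |c j| * (laplaceWeight m u * rexp (-u * a j)) := by
      refine setIntegral_congr_fun measurableSet_Ioi fun u hu => ?_
      simp only [F]
      rw [norm_mul, norm_eq_abs, Real.norm_of_nonneg
        (mul_nonneg (laplaceWeight_nonneg m hu) (Real.exp_pos _).le)]
    have h2 : |c j| = 4 / π * (1 / |4 * (j : ℝ) + 1|) := by
      simp only [c]
      rw [abs_mul, abs_div (σ j), hσ, abs_of_pos (by positivity : 0 < 4 / π)]
    have h3 : |4 * (j : ℝ) + 1| ≠ 0 := abs_ne_zero.2 (four_mul_add_one_ne_zero j)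
    rw [h1, integral_const_mul, integral_laplaceWeight hm (ha j), h2]
    push_cast
    rw [abs_div, abs_one, abs_pow, pow_succ]
    simp only [a]
    rw [mul_pow]
    field_simp
  have hinj : Function.Injective fun j : ℤ => 4 * j + 1 := fun i j hij => by
    simp only at hij; omega
  have hs : Summable fun j => ∫ u in Set.Ioi 0, ‖F j u‖ := by
    simp only [hFn]
    refine Summable.mul_left _ ?_
    exact ((Real.summable_one_div_int_pow (p := m + 1)).2 (by omega)).abs.comp_injective hinj
  have hsum : ∀ u ∈ Set.Ioi (0 : ℝ), HasSum (fun j => F j u)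
      (laplaceWeight m u * ∫ x, ‖remainder n ((-1) ^ m) u x‖ ∂torusMeasure) := by
    intro u hu
    convert! (hasSum_integral_norm_remainder hn m hu).mul_left (laplaceWeight m u) using 2 with j
    simp only [F, c, σ, a]
    ring
  have hmeas : AEStronglyMeasurable
      (fun u => laplaceWeight m u * ∫ x, ‖remainder n ((-1) ^ m) u x‖ ∂torusMeasure)
      (volume.restrict (Set.Ioi 0)) := by
    refine (continuous_laplaceWeight m).aestronglyMeasurable.mul ?_
    exact ((measurable_remainder n ((-1) ^ m)).norm.stronglyMeasurable.integral_prod_right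
      (ν := (torusMeasure : Measure Torus))).aestronglyMeasurable
  refine ⟨integrable_tsum_of_summable_integral_norm hFi hs hmeas
    (ae_restrict_of_forall_mem measurableSet_Ioi hsum), ?_⟩
  have key := hasSum_integral_of_summable_integral_norm hFi hs
  rw [setIntegral_congr_fun measurableSet_Ioi fun u hu => (hsum u hu).tsum_eq] at key
  rw [← key.tsum_eq, favard, ← tsum_mul_left, ← tsum_div_const]
  refine tsum_congr fun j => ?_
  have hj := four_mul_add_one_ne_zero j
  simp only [F]
  rw [integral_const_mul, integral_laplaceWeight hm (ha j)]
  -- The sign `(-1)^m` on negative frequencies converts `|4j+1|^(-m)` into `(4j+1)^(-m)`, as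
  -- Favard's series requires.
  have hσj : σ j * (4 * (j : ℝ) + 1) ^ m = |4 * (j : ℝ) + 1| ^ m := by
    simp only [σ]
    split_ifs with h
    · rw [abs_of_pos h, one_mul]
    · rw [abs_of_nonpos (not_lt.1 h), ← mul_pow, neg_one_mul]
  have habs : |4 * (j : ℝ) + 1| ^ m ≠ 0 := pow_ne_zero _ (abs_ne_zero.2 hj)
  simp only [c, a]
  rw [mul_pow, pow_succ]
  have h5 : σ j / |4 * (j : ℝ) + 1| ^ m = 1 / (4 * (j : ℝ) + 1) ^ m := by
    rw [div_eq_div_iff habs (pow_ne_zero _ hj), one_mul, hσj]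
  calc 4 / π * (σ j / (4 * (j : ℝ) + 1)) * (1 / ((n : ℝ) ^ m * |4 * (j : ℝ) + 1| ^ m))
      = 4 / π * (1 / (4 * (j : ℝ) + 1)) * (1 / (n : ℝ) ^ m)
        * (σ j / |4 * (j : ℝ) + 1| ^ m) := by
        field_simp
    _ = _ := by
        rw [h5]
        field_simp

/-- Favard's theorem on the Bernoulli kernels: an integrable function with Fourier coefficients
`k ^ (-m)` for `|k| ≥ n` and norm `K_m / n ^ m`. -/
theorem exists_favard_remainder {n m : ℕ} (hn : 1 ≤ n) (hm : 1 ≤ m) :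
    ∃ R : Torus → ℂ, Integrable R torusMeasure ∧
      (∀ k : ℤ, (n : ℤ) ≤ |k| → fourierCoeff R k = 1 / (k : ℂ) ^ m) ∧
      ∫ x, ‖R x‖ ∂torusMeasure ≤ favard m / n ^ m := by
  have hε : ((-1) ^ m : ℝ) = 1 ∨ ((-1) ^ m : ℝ) = -1 := neg_one_pow_eq_or ℝ m
  obtain ⟨hint, hval⟩ := integral_laplaceWeight_mul_integral_norm_remainder hn hm
  let H : ℝ × Torus → ℂ := fun p => (laplaceWeight m p.1 : ℂ) * remainder n ((-1) ^ m) p.1 p.2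
  have hnorm : ∀ u ∈ Set.Ioi (0 : ℝ), ∫ x, ‖H (u, x)‖ ∂torusMeasure
      = laplaceWeight m u * ∫ x, ‖remainder n ((-1) ^ m) u x‖ ∂torusMeasure := by
    intro u hu
    simp only [H, norm_mul, Complex.norm_real, norm_of_nonneg (laplaceWeight_nonneg m hu)]
    exact integral_const_mul _ _
  have hHm : AEStronglyMeasurable H ((volume.restrict (Set.Ioi 0)).prod torusMeasure) := by
    refine Measurable.aestronglyMeasurable ?_
    exact (Complex.measurable_ofReal.comp
      ((continuous_laplaceWeight m).measurable.comp measurable_fst)).mul (measurable_remainder n _)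
  have hH : Integrable H ((volume.restrict (Set.Ioi 0)).prod torusMeasure) := by
    rw [integrable_prod_iff hHm]
    refine ⟨ae_restrict_of_forall_mem measurableSet_Ioi fun u hu => ?_, ?_⟩
    · exact (integrable_of_continuous
        (continuous_remainder n ((-1) ^ m) (Set.mem_Ioi.1 hu))).const_mul (laplaceWeight m u : ℂ)
    · exact hint.congr (ae_restrict_of_forall_mem measurableSet_Ioi fun u hu => (hnorm u hu).symm)
  -- `R` is the Laplace superposition of the remainders. Fubini gives its coefficients, and the
  -- triangle inequality with Fubini gives its norm.
  refine ⟨fun x => ∫ u in Set.Ioi 0, H (u, x), hH.integral_prod_right, fun k hk => ?_, ?_⟩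
  · have hk0 : k ≠ 0 := by rintro rfl; simp at hk; omega
    have hkr : (k : ℝ) ≠ 0 := by exact_mod_cast hk0
    have hem : AEStronglyMeasurable (fun p : ℝ × Torus => (fourier (-k) p.2 : ℂ))
        ((volume.restrict (Set.Ioi 0)).prod torusMeasure) :=
      ((fourier (-k)).continuous.comp continuous_snd).aestronglyMeasurable
    have hHk : Integrable (fun p : ℝ × Torus => (fourier (-k) p.2 : ℂ) * H p)
        ((volume.restrict (Set.Ioi 0)).prod torusMeasure) :=
      hH.bdd_mul (c := 1) hem (Eventually.of_forall fun p => (norm_fourier_apply (-k) p.2).le)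
    have hswap := integral_integral_swap
      (f := fun (u : ℝ) (x : Torus) => (fourier (-k) x : ℂ) * H (u, x)) hHk
    have h1 : fourierCoeff (fun x => ∫ u in Set.Ioi 0, H (u, x)) k
        = ∫ u in Set.Ioi 0, ∫ x, (fourier (-k) x : ℂ) * H (u, x) ∂torusMeasure := by
      rw [hswap]
      simp only [fourierCoeff, smul_eq_mul]
      refine integral_congr_ae (Eventually.of_forall fun x => ?_)
      exact (integral_const_mul _ _).symm
    have h2 : ∀ u ∈ Set.Ioi (0 : ℝ), ∫ x, (fourier (-k) x : ℂ) * H (u, x) ∂torusMeasure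
        = (((if 0 < k then 1 else (-1) ^ m)
          * (laplaceWeight m u * rexp (-u * |(k : ℝ)|)) : ℝ) : ℂ) := by
      intro u hu
      have h3 := fourierCoeff.const_mul (remainder n ((-1) ^ m) u) (laplaceWeight m u : ℂ) k
      rw [fourierCoeff_remainder hn hε hu hk] at h3
      refine h3.trans ?_
      rw [← Complex.ofReal_mul]
      congr 1
      ring
    rw [h1, setIntegral_congr_fun measurableSet_Ioi h2, integral_complex_ofReal,
      integral_const_mul, integral_laplaceWeight hm (abs_pos.2 hkr)]
    have h4 : (if 0 < k then 1 else (-1) ^ m) * (1 / |(k : ℝ)| ^ m) = 1 / (k : ℝ) ^ m := by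
      split_ifs with h
      · rw [abs_of_pos (by exact_mod_cast h), one_mul]
      · have hk' : (k : ℝ) ≤ 0 := by exact_mod_cast not_lt.1 h
        rw [abs_of_nonpos hk', neg_pow (k : ℝ), mul_one_div,
          div_mul_cancel_left₀ (pow_ne_zero _ (by norm_num)), one_div]
    rw [h4]
    push_cast
    rfl
  · calc ∫ x, ‖∫ u in Set.Ioi 0, H (u, x)‖ ∂torusMeasure
        ≤ ∫ x, (∫ u in Set.Ioi 0, ‖H (u, x)‖) ∂torusMeasure :=
          integral_mono hH.integral_prod_right.norm hH.norm.integral_prod_right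
            fun x => norm_integral_le_integral_norm _
      _ = ∫ u in Set.Ioi 0, ∫ x, ‖H (u, x)‖ ∂torusMeasure :=
          (integral_integral_swap (f := fun u x => ‖H (u, x)‖) hH.norm).symm
      _ = favard m / n ^ m := by
          rw [setIntegral_congr_fun measurableSet_Ioi hnorm, hval]

end SteklovKernel

end

theorem mainTheorem3 (n m : ℕ) (hn : 1 ≤ n) (hm : 1 ≤ m) :
    (∀ h : ℝ, 0 < h → h ≤ 1 / (2 * (m : ℝ) * (n : ℝ)) →
      SteklovKernel.bestApproxL1 (n - 1) (SteklovKernel.chiPow h m) = 1) ∧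
    (∀ h : ℝ, 0 < h →
      SteklovKernel.bestApproxL1 (n - 1) (SteklovKernel.chiPow h m) ≤
        ENNReal.ofReal (SteklovKernel.favard m / (π * h * (n : ℝ)) ^ m)) ∧
    (∀ k : ℕ, 1 ≤ k → k ≤ n → ∀ h : ℝ, h = (2 * (k : ℝ) - 1) / (2 * (n : ℝ)) →
      SteklovKernel.bestApproxL1 (n - 1) (SteklovKernel.chiPow h m) =
        ENNReal.ofReal (SteklovKernel.favard m / (π * h * (n : ℝ)) ^ m)) := by
  have hle : ∀ h : ℝ, 0 < h →
      SteklovKernel.bestApproxL1 (n - 1) (SteklovKernel.chiPow h m) ≤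
        ENNReal.ofReal (SteklovKernel.favard m / (π * h * (n : ℝ)) ^ m) := by
    intro h h0
    obtain ⟨R, hR, hRc, hRn⟩ := SteklovKernel.exists_favard_remainder hn hm
    exact SteklovKernel.bestApproxL1_chiPow_le hn hm h0 hR hRc hRn
  refine ⟨fun h h0 hh => SteklovKernel.bestApproxL1_chiPow_eq_one hn hm h0 hh, hle,
    fun k hk hkn h hh => ?_⟩
  have hk' : (1 : ℝ) ≤ k := by exact_mod_cast hk
  have hn' : (1 : ℝ) ≤ n := by exact_mod_cast hn
  have h0 : 0 < h := by
    rw [hh]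
    exact div_pos (by linarith) (by linarith)
  exact le_antisymm (hle h h0) (SteklovKernel.favard_div_le_bestApproxL1 hn hm hk hkn hh)
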